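/- Let $\kappa,\tau\in\mathbb R$. The BCV-space $\mathcal N_{\kappa,\tau}$ is the set of $(x,y,z)\in\mathbb R^3$ with $B=1+\frac\kappa4(x^2+y^2)>0$, with the Riemannian metric $$g_{\kappa,\tau}=\frac{dx^2+dy^2}{B^2}+\Big(dz+\tau\,\frac{y\,dx-x\,dy}{B}\Big)^2 .$$ Let $m\neq0$ and $a$ be real, let $I\subseteq\mathbb R$ be a nonempty open interval and $U:I\to(0,\infty)$ a $C^2$ function. Put $\Delta=(1-2a\tau)^2+(m^2U^2-a^2)(4\tau^2-\kappa)$, $$\xi_1=2\sqrt{\frac{m^2U^2-a^2}{(1+\sqrt\Delta)^2-4\tau^2m^2U^2}},\qquad R=\xi_1^2-\frac{m^4U^2U'^2(4+\kappa\xi_1^2)^2}{16\Delta},$$ and assume that these formulas are meaningful on $I$ and define points of $\mathcal N_{\kappa,\tau}$ off the $z$-axis: $\Delta>0$, the quotient under the root in $\xi_1$ is positive, $4+\kappa\xi_1^2>0$ and $R\ge0$ on $I$. Let $$\xi_2(u)=\int\frac{mU(4+\kappa\xi_1^2)}{4\xi_1^2}\sqrt R\,du,\qquad \theta(u,t)=\frac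 tm+\int\frac{(4\tau-a\kappa)\xi_1^2-4a}{4mU\xi_1^2}\sqrt R\,du$$ (with any antiderivatives), and let $\Psi(u,t)=(\xi_1(u),\theta(u,t),\xi_2(u)+a\,\theta(u,t))$, $(u,t)\in I\times\mathbb R$, in cylindrical coordinates $(r,\theta,z)$, be the corresponding helicoidal surface of the Bour family. Call $\Psi$ minimal if it is a $C^2$ immersed surface in $(\mathcal N_{\kappa,\tau},g_{\kappa,\tau})$ with identically vanishing mean curvature. Then $\Psi$ is minimal if and only if there are real constants $c$ and $u_0$ such that, with $v=u-u_0$, the following holds for all $u\in I$: 1. if $\kappa=\tau=0$ (the case of $\mathbb R^3$): $$U^2(u)=\frac{v^2+a^2+c^2/4}{m^2};$$ 2. if $\kappa=4\tau^2\neq0$ (the case of $\mathbb S^3(\tau^2)$): $$U^2(u)=\frac{1-2a\tau+2a^2\tau^2+\sqrt{(1-2a\tau)^2-\tau^2c^2}\,\sin(2\tau v)}{2m^2\tau^2},\qquad |c|\le|1/\tau-2a|;$$ 3. if $\kappa>0$, $\tau=0$ (the case of $\mathbb S^2(\kappa)\times\mathbb R$): $$U^2(u)=\frac{\kappa(a^2\kappa+1)+(c^2-\kappa)\sin^2(\sqrt\kappa\,v)}{m^2\kappa^2},\qquad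 |c|\le\sqrt\kappa;$$ 4. if $\kappa<0$, $\tau=0$ (the case of $\mathbb H^2(\kappa)\times\mathbb R$): $$U^2(u)=\frac{\kappa(a^2\kappa+1)+(c^2-\kappa)\cosh^2(\sqrt{-\kappa}\,v)}{m^2\kappa^2};$$ 5. if $\kappa=0$, $\tau\neq0$ (the case of the Heisenberg space $\mathbb H_3$): $$U^2(u)=\frac{W^2+4a\tau-1}{4m^2\tau^2},\qquad W=2\tau^2v^2+1-2a\tau+\frac{c^2}{8\tau^2}>0;$$ 6. if $\kappa>0$, $\tau\neq0$, $\kappa\neq4\tau^2$ (the case of $\mathrm{SU}(2)$): $$U^2(u)=\frac{\kappa^2(4a\tau-a^2\kappa-1)+W^2}{m^2\kappa^2(4\tau^2-\kappa)},\qquad W=4\tau^2-2a\kappa\tau+\sqrt{(4\tau^2-\kappa)^2-c^2\kappa}\,\sin(\sqrt\kappa\,v)>0,\qquad |c|\le\frac{|4\tau^2-\kappa|}{\sqrt\kappa};$$ 7. if $\kappa<0$, $\tau\neq0$ (the case of $\widetilde{\mathrm{SL}(2,\mathbb R)}$): $$U^2(u)=\frac{\kappa^2(4a\tau-a^2\kappa-1)+W^2}{m^2\kappa^2(4\tau^2-\kappa)},\qquad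 W=4\tau^2-2a\kappa\tau-\sqrt{(4\tau^2-\kappa)^2-c^2\kappa}\,\cosh(\sqrt{-\kappa}\,v)<0.$$ -/

import Mathlib

/-! ### Surfaces in an open set of `ℝ³` carrying a Riemannian metric

A metric on an open subset of `ℝ³` is given in the standard coordinates as a function
`g : ℝ³ → ℝ³ → ℝ³ → ℝ`, where `g p X Y` is the inner product of `X` and `Y` at `p`.
Only the topology and the coordinates of `Fin 3 → ℝ` are used, never its norm. -/

/-- Christoffel symbols of the first kind, contracted with constant vector fields `X`, `Y`, `Z`:
`g (∇_X Y, Z) = (X g(Y,Z) + Y g(X,Z) - Z g(X,Y)) / 2` for the Levi-Civita connection. -/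
noncomputable def christoffelFirst (g : (Fin 3 → ℝ) → (Fin 3 → ℝ) → (Fin 3 → ℝ) → ℝ)
    (p X Y Z : Fin 3 → ℝ) : ℝ :=
  (fderiv ℝ (fun q => g q Y Z) p X + fderiv ℝ (fun q => g q X Z) p Y
    - fderiv ℝ (fun q => g q X Y) p Z) / 2

/-- Partial derivative of a map of two variables with respect to the first one. -/
noncomputable def partialU (Ψ : ℝ × ℝ → (Fin 3 → ℝ)) (q : ℝ × ℝ) : Fin 3 → ℝ :=
  deriv (fun s => Ψ (s, q.2)) q.1

/-- Partial derivative of a map of two variables with respect to the second one. -/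
noncomputable def partialT (Ψ : ℝ × ℝ → (Fin 3 → ℝ)) (q : ℝ × ℝ) : Fin 3 → ℝ :=
  deriv (fun s => Ψ (q.1, s)) q.2

/-- `ν` is a unit normal vector of the parametrized surface `Ψ` at the parameter `q`. -/
def IsUnitNormal (g : (Fin 3 → ℝ) → (Fin 3 → ℝ) → (Fin 3 → ℝ) → ℝ)
    (Ψ : ℝ × ℝ → (Fin 3 → ℝ)) (q : ℝ × ℝ) (ν : Fin 3 → ℝ) : Prop :=
  g (Ψ q) ν ν = 1 ∧ g (Ψ q) (partialU Ψ q) ν = 0 ∧ g (Ψ q) (partialT Ψ q) ν = 0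

/-- The mean curvature (half the trace of the second fundamental form) of the parametrized surface
`Ψ` at `q` with respect to the normal vector `ν`. Here `E, F, G` are the coefficients of the first
fundamental form, and `L = g(∇_u Ψ_u, ν)`, `M = g(∇_u Ψ_t, ν)`, `N = g(∇_t Ψ_t, ν)` those of the
second one, `∇` being the Levi-Civita connection of `g` along `Ψ`. -/
noncomputable def meanCurvature (g : (Fin 3 → ℝ) → (Fin 3 → ℝ) → (Fin 3 → ℝ) → ℝ)
    (Ψ : ℝ × ℝ → (Fin 3 → ℝ)) (q : ℝ × ℝ) (ν : Fin 3 → ℝ) : ℝ :=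
  let p := Ψ q
  let Ψu := partialU Ψ q
  let Ψt := partialT Ψ q
  let E := g p Ψu Ψu
  let F := g p Ψu Ψt
  let G := g p Ψt Ψt
  let L := g p (partialU (partialU Ψ) q) ν + christoffelFirst g p Ψu Ψu ν
  let M := g p (partialU (partialT Ψ) q) ν + christoffelFirst g p Ψu Ψt ν
  let N := g p (partialT (partialT Ψ) q) ν + christoffelFirst g p Ψt Ψt ν
  (E * N - 2 * F * M + G * L) / (2 * (E * G - F ^ 2))

/-- `Ψ`, restricted to the open set `Ω` of parameters, is a (twice continuously differentiable)
immersed surface in `(S, g)` whose mean curvature vanishes identically. -/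
structure IsMinimalSurface (g : (Fin 3 → ℝ) → (Fin 3 → ℝ) → (Fin 3 → ℝ) → ℝ)
    (S : Set (Fin 3 → ℝ)) (Ω : Set (ℝ × ℝ)) (Ψ : ℝ × ℝ → (Fin 3 → ℝ)) : Prop where
  contDiffOn : ContDiffOn ℝ 2 Ψ Ω
  mapsTo : Set.MapsTo Ψ Ω S
  immersion : ∀ q ∈ Ω, LinearIndependent ℝ ![partialU Ψ q, partialT Ψ q]
  meanCurvature_eq_zero : ∀ q ∈ Ω, ∀ ν, IsUnitNormal g Ψ q ν → meanCurvature g Ψ q ν = 0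

/-! ### Bianchi-Cartan-Vranceanu spaces -/

/-- The function `B = 1 + (κ/4)(x² + y²)`. -/
noncomputable def bcvB (κ : ℝ) (p : Fin 3 → ℝ) : ℝ := 1 + κ / 4 * (p 0 ^ 2 + p 1 ^ 2)

/-- The BCV-space `𝒩_{κ,τ}`: the open subset of `ℝ³` where `B > 0`. -/
def bcvSpace (κ : ℝ) : Set (Fin 3 → ℝ) := {p | 0 < bcvB κ p}

/-- The BCV metric `(dx² + dy²)/B² + (dz + τ (y dx - x dy)/B)²`. -/
noncomputable def bcvMetric (κ τ : ℝ) (p X Y : Fin 3 → ℝ) : ℝ :=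
  (X 0 * Y 0 + X 1 * Y 1) / bcvB κ p ^ 2
    + (X 2 + τ * ((p 1 * X 0 - p 0 * X 1) / bcvB κ p))
      * (Y 2 + τ * ((p 1 * Y 0 - p 0 * Y 1) / bcvB κ p))

/-! ### The Bour family of helicoidal surfaces -/

/-- `Δ(u) = (1 - 2aτ)² + (m² U(u)² - a²)(4τ² - κ)`. -/
noncomputable def bourDelta (κ τ m a : ℝ) (U : ℝ → ℝ) (u : ℝ) : ℝ :=
  (1 - 2 * a * τ) ^ 2 + (m ^ 2 * U u ^ 2 - a ^ 2) * (4 * τ ^ 2 - κ)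

/-- The quotient under the root in `ξ₁ = 2 √((m²U² - a²)/((1 + √Δ)² - 4τ²m²U²))`. -/
noncomputable def bourQuotient (κ τ m a : ℝ) (U : ℝ → ℝ) (u : ℝ) : ℝ :=
  (m ^ 2 * U u ^ 2 - a ^ 2)
    / ((1 + Real.sqrt (bourDelta κ τ m a U u)) ^ 2 - 4 * τ ^ 2 * m ^ 2 * U u ^ 2)

/-- The first component `ξ₁` of the profile curve. -/
noncomputable def bourXi1 (κ τ m a : ℝ) (U : ℝ → ℝ) (u : ℝ) : ℝ :=
  2 * Real.sqrt (bourQuotient κ τ m a U u)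

/-- The expression `ξ₁² - m⁴ U² U'² (4 + κ ξ₁²)² / (16 Δ)`. -/
noncomputable def bourRadicand (κ τ m a : ℝ) (U : ℝ → ℝ) (u : ℝ) : ℝ :=
  bourXi1 κ τ m a U u ^ 2
    - m ^ 4 * U u ^ 2 * deriv U u ^ 2 * (4 + κ * bourXi1 κ τ m a U u ^ 2) ^ 2
      / (16 * bourDelta κ τ m a U u)

/-- The integrand of `ξ₂`. -/
noncomputable def bourXi2Integrand (κ τ m a : ℝ) (U : ℝ → ℝ) (u : ℝ) : ℝ :=
  m * U u * (4 + κ * bourXi1 κ τ m a U u ^ 2) / (4 * bourXi1 κ τ m a U u ^ 2)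
    * Real.sqrt (bourRadicand κ τ m a U u)

/-- The integrand of `θ - t/m`. -/
noncomputable def bourThetaIntegrand (κ τ m a : ℝ) (U : ℝ → ℝ) (u : ℝ) : ℝ :=
  ((4 * τ - a * κ) * bourXi1 κ τ m a U u ^ 2 - 4 * a) / (4 * m * U u * bourXi1 κ τ m a U u ^ 2)
    * Real.sqrt (bourRadicand κ τ m a U u)

/-- The data for which the formulas of the Bour family make sense on the parameter interval `I` and
give a surface in the BCV-space: `U` is positive and twice continuously differentiable, the
expressions under the square roots have the right sign, no denominator vanishes, and the profile
curve stays off the axis (`ξ₁ > 0`) and in the region `B > 0`. -/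
structure BourAdmissible (κ τ m a : ℝ) (U : ℝ → ℝ) (I : Set ℝ) : Prop where
  m_ne_zero : m ≠ 0
  contDiffOn : ContDiffOn ℝ 2 U I
  pos : ∀ u ∈ I, 0 < U u
  delta_pos : ∀ u ∈ I, 0 < bourDelta κ τ m a U u
  quotient_pos : ∀ u ∈ I, 0 < bourQuotient κ τ m a U u
  B_pos : ∀ u ∈ I, 0 < 1 + κ / 4 * bourXi1 κ τ m a U u ^ 2
  radicand_nonneg : ∀ u ∈ I, 0 ≤ bourRadicand κ τ m a U u

/-- The surface `Ψ(u,t) = (ξ₁(u), θ(u,t), ξ₂(u) + a θ(u,t))`, `θ(u,t) = t/m + ϑ(u)`, where the triple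
on the right consists of cylindrical coordinates `(r, θ, z)`. -/
noncomputable def bourSurface (κ τ m a : ℝ) (U ξ₂ ϑ : ℝ → ℝ) (q : ℝ × ℝ) : Fin 3 → ℝ :=
  ![bourXi1 κ τ m a U q.1 * Real.cos (q.2 / m + ϑ q.1),
    bourXi1 κ τ m a U q.1 * Real.sin (q.2 / m + ϑ q.1),
    ξ₂ q.1 + a * (q.2 / m + ϑ q.1)]

/-- The helicoidal surface of the Bour family, with parameters `(u, t) ∈ I × ℝ`, is a minimal
surface of the BCV-space `𝒩_{κ,τ}`. -/
def IsMinimalBourSurface (κ τ m a : ℝ) (U ξ₂ ϑ : ℝ → ℝ) (I : Set ℝ) : Prop :=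
  IsMinimalSurface (bcvMetric κ τ) (bcvSpace κ) (I ×ˢ Set.univ) (bourSurface κ τ m a U ξ₂ ϑ)

/-! Everything is governed by s = ξ₁²/B and q = √R/B. Write ω = mU for the length of the Killing
field K = ∂_θ + a ∂_z. Solving the definition of ξ₁ for U shows that m²U² is a polynomial of degree
at most two in s, namely a² + (1 − 2aτ)s + (4τ² − κ)s²/4, whose derivative in s is √Δ
(`BourAdmissible.mul_U_sq`, `BourAdmissible.sqrt_delta`). Hence R = ξ₁²(1 − ξ₁'²/B²), and q² = s −
κs²/4 − s'²/4.

In the parameters (u, t) the first fundamental form is du² + U² dt². The mean curvature is computed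
at (ρ, 0, z) after a rotation, which is an isometry. Up to a nonvanishing factor it equals q's' + qP
with P = 2 − κs − s'' (`meanCurvature_eq_zero_iff`). Differentiating the formula for q² gives 4qq' =
s'P. As linear equations in q' and P, these two have determinant s'² + 4q² = s(4 − κs) up to sign,
and this is positive. So minimality forces q' = 0 and P = 0, and conversely P = 0 makes q constant
(`BourAdmissible.isMinimal_iff`).

It remains to solve s'' = 2 − κs and insert s into the polynomial for m²U². The value of q is a
first integral and c is a multiple of it; u₀ is the phase. For the converse, s must be recovered
from U². Completing the square determines √Δ up to sign, and the sign comes from √Δ > 0. This is the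
origin of the conditions on W, which is √Δ when κ = 0 and κ√Δ otherwise. -/

/-! ### Rotations about the `z`-axis -/

/-- Rotation by the angle `φ` about the `z`-axis. -/
noncomputable def rotZ (φ : ℝ) (X : Fin 3 → ℝ) : Fin 3 → ℝ :=
  ![Real.cos φ * X 0 - Real.sin φ * X 1, Real.sin φ * X 0 + Real.cos φ * X 1, X 2]

theorem rotZ_neg_cancel (φ : ℝ) (X : Fin 3 → ℝ) : rotZ φ (rotZ (-φ) X) = X := by
  have h := Real.sin_sq_add_cos_sq φ
  ext i
  fin_cases i
  · simp [rotZ]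
    linear_combination X 0 * h
  · simp [rotZ]
    linear_combination X 1 * h
  · simp [rotZ]

theorem rotZ_add_smul (φ t : ℝ) (p X : Fin 3 → ℝ) :
    rotZ φ p + t • rotZ φ X = rotZ φ (p + t • X) := by
  ext i
  fin_cases i <;> simp [rotZ] <;> ring

theorem bcvB_rotZ (κ φ : ℝ) (p : Fin 3 → ℝ) : bcvB κ (rotZ φ p) = bcvB κ p := by
  have h := Real.sin_sq_add_cos_sq φ
  simp only [bcvB, rotZ, Matrix.cons_val_zero, Matrix.cons_val_one]
  linear_combination (κ / 4 * (p 0 ^ 2 + p 1 ^ 2)) * h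

theorem bcvMetric_rotZ (κ τ φ : ℝ) (p X Y : Fin 3 → ℝ) :
    bcvMetric κ τ (rotZ φ p) (rotZ φ X) (rotZ φ Y) = bcvMetric κ τ p X Y := by
  have h := Real.sin_sq_add_cos_sq φ
  have hdot : rotZ φ X 0 * rotZ φ Y 0 + rotZ φ X 1 * rotZ φ Y 1 = X 0 * Y 0 + X 1 * Y 1 := by
    simp only [rotZ, Matrix.cons_val_zero, Matrix.cons_val_one]
    linear_combination (X 0 * Y 0 + X 1 * Y 1) * h
  have hdet (Z : Fin 3 → ℝ) :
      rotZ φ p 1 * rotZ φ Z 0 - rotZ φ p 0 * rotZ φ Z 1 = p 1 * Z 0 - p 0 * Z 1 := by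
    simp only [rotZ, Matrix.cons_val_zero, Matrix.cons_val_one]
    linear_combination (p 1 * Z 0 - p 0 * Z 1) * h
  have h2 (Z : Fin 3 → ℝ) : rotZ φ Z 2 = Z 2 := rfl
  rw [bcvMetric, bcvB_rotZ, hdot, hdet, hdet, h2, h2, bcvMetric]

/-- In a rotating frame differentiation adds φ' times the quarter turn of the horizontal part. All
partial derivatives of a helicoidal surface therefore stay rotated vectors with a common angle,
which then drops out of every metric quantity. -/
theorem hasDerivAt_rotZ {φ f₀ f₁ f₂ : ℝ → ℝ} {φ' f₀' f₁' f₂' x : ℝ} (hφ : HasDerivAt φ φ' x)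
    (h₀ : HasDerivAt f₀ f₀' x) (h₁ : HasDerivAt f₁ f₁' x) (h₂ : HasDerivAt f₂ f₂' x) :
    HasDerivAt (fun s => rotZ (φ s) ![f₀ s, f₁ s, f₂ s])
      (rotZ (φ x) ![f₀' - φ' * f₁ x, f₁' + φ' * f₀ x, f₂']) x := by
  rw [hasDerivAt_pi]
  intro i
  fin_cases i
  · refine ((hφ.cos.fun_mul h₀).fun_sub (hφ.sin.fun_mul h₁)).congr_deriv ?_
    simp [rotZ]
    ring
  · refine ((hφ.sin.fun_mul h₀).fun_add (hφ.cos.fun_mul h₁)).congr_deriv ?_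
    simp [rotZ]
    ring
  · exact h₂

/-! ### First derivatives of the BCV metric -/

/-- Rotations carry lines to lines, so derivatives along lines transfer the rotation invariance of
the metric to its Christoffel symbols; they also reduce the computation at (ρ, 0, z) to one
variable. -/
theorem fderiv_bcvMetric_apply {κ : ℝ} (τ : ℝ) {p : Fin 3 → ℝ} (hB : bcvB κ p ≠ 0)
    (X Y Z : Fin 3 → ℝ) :
    fderiv ℝ (fun q => bcvMetric κ τ q Y Z) p X
      = deriv (fun t : ℝ => bcvMetric κ τ (p + t • X) Y Z) 0 := by
  have hd : DifferentiableAt ℝ (fun q => bcvMetric κ τ q Y Z) p := by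
    have hb : DifferentiableAt ℝ (fun q => bcvB κ q) p := by
      unfold bcvB
      fun_prop
    unfold bcvMetric
    have hB2 : bcvB κ p ^ 2 ≠ 0 := pow_ne_zero 2 hB
    fun_prop (disch := assumption)
  exact hd.lineDeriv_eq_fderiv.symm

theorem christoffelFirst_bcvMetric_rotZ {κ : ℝ} (τ φ : ℝ) {p : Fin 3 → ℝ} (hB : bcvB κ p ≠ 0)
    (X Y Z : Fin 3 → ℝ) :
    christoffelFirst (bcvMetric κ τ) (rotZ φ p) (rotZ φ X) (rotZ φ Y) (rotZ φ Z)
      = christoffelFirst (bcvMetric κ τ) p X Y Z := by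
  have hB' : bcvB κ (rotZ φ p) ≠ 0 := by rwa [bcvB_rotZ]
  simp only [christoffelFirst, fderiv_bcvMetric_apply τ hB, fderiv_bcvMetric_apply τ hB',
    rotZ_add_smul, bcvMetric_rotZ]

theorem fderiv_bcvMetric_axis {κ : ℝ} (τ : ℝ) {ρ z B : ℝ} (hB : B = 1 + κ / 4 * ρ ^ 2) (hB0 : B ≠ 0)
    (X Y Z : Fin 3 → ℝ) :
    fderiv ℝ (fun q => bcvMetric κ τ q Y Z) ![ρ, 0, z] X
      = -(κ * ρ * X 0 * (Y 0 * Z 0 + Y 1 * Z 1) / B ^ 3)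
        + τ * ((X 1 * Y 0 - X 0 * Y 1) / B + κ * ρ ^ 2 * X 0 * Y 1 / (2 * B ^ 2))
          * (Z 2 - τ * ρ * Z 1 / B)
        + τ * ((X 1 * Z 0 - X 0 * Z 1) / B + κ * ρ ^ 2 * X 0 * Z 1 / (2 * B ^ 2))
          * (Y 2 - τ * ρ * Y 1 / B) := by
  have hBp : bcvB κ ![ρ, 0, z] = B := by simp [bcvB, hB]
  rw [fderiv_bcvMetric_apply τ (hBp ▸ hB0)]
  have hx : HasDerivAt (fun t : ℝ => ρ + t * X 0) (X 0) 0 := by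
    simpa using ((hasDerivAt_id (0 : ℝ)).mul_const (X 0)).const_add ρ
  have hy : HasDerivAt (fun t : ℝ => t * X 1) (X 1) 0 := by
    simpa using (hasDerivAt_id (0 : ℝ)).mul_const (X 1)
  have hb : HasDerivAt (fun t : ℝ => 1 + κ / 4 * ((ρ + t * X 0) ^ 2 + (t * X 1) ^ 2))
      (κ / 2 * ρ * X 0) 0 :=
    ((((hx.fun_pow 2).fun_add (hy.fun_pow 2)).const_mul (κ / 4)).const_add 1).congr_deriv
      (by simp; ring)
  have hb0 : 1 + κ / 4 * ((ρ + 0 * X 0) ^ 2 + (0 * X 1) ^ 2) = B := by rw [hB]; ring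
  have hb0' : 1 + κ / 4 * ((ρ + 0 * X 0) ^ 2 + (0 * X 1) ^ 2) ≠ 0 := by rwa [hb0]
  have hw (V : Fin 3 → ℝ) := ((((hy.mul_const (V 0)).fun_sub (hx.mul_const (V 1))).fun_div hb
    hb0').const_mul τ).const_add (V 2)
  have hmain := ((hasDerivAt_const (0 : ℝ) (Y 0 * Z 0 + Y 1 * Z 1)).fun_div (hb.fun_pow 2)
    (pow_ne_zero 2 hb0')).fun_add ((hw Y).fun_mul (hw Z))
  have heq (t : ℝ) : bcvMetric κ τ (![ρ, 0, z] + t • X) Y Z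
      = (Y 0 * Z 0 + Y 1 * Z 1) / (1 + κ / 4 * ((ρ + t * X 0) ^ 2 + (t * X 1) ^ 2)) ^ 2
        + (Y 2 + τ * ((t * X 1 * Y 0 - (ρ + t * X 0) * Y 1)
            / (1 + κ / 4 * ((ρ + t * X 0) ^ 2 + (t * X 1) ^ 2))))
          * (Z 2 + τ * ((t * X 1 * Z 0 - (ρ + t * X 0) * Z 1)
            / (1 + κ / 4 * ((ρ + t * X 0) ^ 2 + (t * X 1) ^ 2)))) := by
    simp [bcvMetric, bcvB]
  refine ((hmain.congr_of_eventuallyEq (.of_forall heq)).congr_deriv ?_).deriv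
  simp only [hb0]
  field_simp
  ring

/-! ### The second fundamental form of a helicoidal surface -/

theorem bcvMetric_axis {κ : ℝ} (τ : ℝ) {ρ z B : ℝ} (hB : B = 1 + κ / 4 * ρ ^ 2)
    (X Y : Fin 3 → ℝ) :
    bcvMetric κ τ ![ρ, 0, z] X Y
      = (X 0 * Y 0 + X 1 * Y 1) / B ^ 2
        + (X 2 - τ * ρ * X 1 / B) * (Y 2 - τ * ρ * Y 1 / B) := by
  have hBp : bcvB κ ![ρ, 0, z] = B := by simp [bcvB, hB]
  rw [bcvMetric, hBp]
  simp
  ring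

theorem christoffelFirst_bcvMetric_axis {κ : ℝ} (τ : ℝ) {ρ z B : ℝ} (hB : B = 1 + κ / 4 * ρ ^ 2)
    (hB0 : B ≠ 0) (X Z : Fin 3 → ℝ) :
    christoffelFirst (bcvMetric κ τ) ![ρ, 0, z] X X Z
      = κ * ρ / (2 * B ^ 3) * ((X 0 ^ 2 + X 1 ^ 2) * Z 0 - 2 * X 0 * (X 0 * Z 0 + X 1 * Z 1))
        + τ * κ * ρ ^ 2 * X 0 * X 1 / (2 * B ^ 2) * (Z 2 - τ * ρ * Z 1 / B)
        + 2 * τ / B ^ 2 * (X 2 - τ * ρ * X 1 / B) * (X 1 * Z 0 - X 0 * Z 1) := by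
  rw [christoffelFirst, fderiv_bcvMetric_axis τ hB hB0, fderiv_bcvMetric_axis τ hB hB0]
  have h : κ * ρ ^ 2 = 4 * (B - 1) := by rw [hB]; ring
  field_simp
  linear_combination (τ * (X 2 * B - τ * ρ * X 1) * (X 1 * Z 0 - X 0 * Z 1) * (-2)) * h

/-- `g(∇_t Ψ_t, Z)` for a helicoidal surface. -/
theorem secondForm_tt {κ τ m a ρ z B : ℝ} (hm : m ≠ 0) (hB : B = 1 + κ / 4 * ρ ^ 2) (hB0 : B ≠ 0)
    (Z : Fin 3 → ℝ) :
    bcvMetric κ τ ![ρ, 0, z] ![-(ρ / m ^ 2), 0, 0] Z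
        + christoffelFirst (bcvMetric κ τ) ![ρ, 0, z] ![0, ρ / m, a / m] ![0, ρ / m, a / m] Z
      = -((1 - 2 * a * τ + (4 * τ ^ 2 - κ) * ρ ^ 2 / (2 * B)) * ρ * Z 0 / (B ^ 2 * m ^ 2)) := by
  -- Since K = (0, ρ, a) is Killing, its acceleration is −½ grad ω². As ω depends on the radius
  -- only, just `Z 0` survives.
  rw [bcvMetric_axis τ hB, christoffelFirst_bcvMetric_axis τ hB hB0]
  simp
  field_simp
  ring

/-- `g(∇_u Ψ_u, ν)` for a helicoidal surface in Bour coordinates and its unit normal `ν`. -/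
theorem secondForm_uu {κ τ a ρ z B b ρ₁ ρ₂ q q₁ ω ω₁ ϑ₁ ϑ₂ ζ₁ ζ₂ s₁ s₂ D : ℝ} (hρ : ρ ≠ 0)
    (hω : ω ≠ 0) (hB : B = 1 + κ / 4 * ρ ^ 2) (hB0 : B ≠ 0) (hb : b = a - τ * ρ ^ 2 / B)
    (hωsq : ω ^ 2 = ρ ^ 2 / B ^ 2 + b ^ 2)
    (hqsq : q ^ 2 = ρ ^ 2 / B ^ 2 - ρ ^ 2 * ρ₁ ^ 2 / B ^ 4)
    (hD : D = 1 - 2 * a * τ + (4 * τ ^ 2 - κ) * ρ ^ 2 / (2 * B))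
    (hω₁ : ω₁ = ρ * ρ₁ * D / (B ^ 2 * ω))
    (hs₁ : s₁ = 2 * ρ * ρ₁ / B ^ 2)
    (hs₂ : s₂ = 2 * (ρ₁ ^ 2 + ρ * ρ₂) / B ^ 2 - 2 * κ * ρ ^ 2 * ρ₁ ^ 2 / B ^ 3)
    (hϑ₁ : ϑ₁ = -(b * B ^ 2 * q / (ρ ^ 2 * ω)))
    (hϑ₂ : ϑ₂ = -(((-τ * s₁) * B ^ 2 * q + b * B * (κ * ρ * ρ₁) * q + b * B ^ 2 * q₁) / (ρ ^ 2 * ω))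
      + b * B ^ 2 * q * (2 * ρ * ρ₁ * ω + ρ ^ 2 * ω₁) / (ρ ^ 2 * ω) ^ 2)
    (hζ₁ : ζ₁ = ω * B ^ 2 * q / ρ ^ 2)
    (hζ₂ : ζ₂ = (ω₁ * B ^ 2 * q + ω * B * (κ * ρ * ρ₁) * q + ω * B ^ 2 * q₁) / ρ ^ 2
      - 2 * ω * B ^ 2 * q * ρ₁ / ρ ^ 3)
    (Z : Fin 3 → ℝ) (hZ₀ : Z 0 = q * B ^ 2 / ρ) (hZ₁ : Z 1 = b * ρ₁ / ω)
    (hZ₂ : Z 2 - τ * ρ * Z 1 / B = -(ρ₁ * ρ / (B ^ 2 * ω))) :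
    bcvMetric κ τ ![ρ, 0, z]
          ![ρ₂ - ϑ₁ * (ϑ₁ * ρ), ϑ₂ * ρ + ϑ₁ * ρ₁ + ϑ₁ * ρ₁, ζ₂ + a * ϑ₂] Z
        + christoffelFirst (bcvMetric κ τ) ![ρ, 0, z] ![ρ₁, ϑ₁ * ρ, ζ₁ + a * ϑ₁]
            ![ρ₁, ϑ₁ * ρ, ζ₁ + a * ϑ₁] Z
      = -(B ^ 2 / (2 * ρ ^ 2) * (q₁ * s₁ + q * (2 - κ * ρ ^ 2 / B - s₂))) + D * q / ω ^ 2 := by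
  rw [bcvMetric_axis τ hB, christoffelFirst_bcvMetric_axis τ hB hB0, hZ₂]
  -- Eliminating κ and a in favour of B and b leaves the quadratic relations for ω² and q² as the
  -- constraints to be used.
  have hκ : κ = 4 * (B - 1) / ρ ^ 2 := by rw [hB]; field_simp; ring
  have ha : a = b + τ * ρ ^ 2 / B := by rw [hb]; ring
  have hY : ζ₁ + a * ϑ₁ - τ * ρ * (ϑ₁ * ρ) / B = q / ω := by
    have h1 : ζ₁ + a * ϑ₁ - τ * ρ * (ϑ₁ * ρ) / B = ζ₁ + b * ϑ₁ := by rw [hb]; ring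
    have h2 : ρ ^ 2 / B ^ 2 = ω ^ 2 - b ^ 2 := by linarith
    have h3 : ρ ^ 2 = (ω ^ 2 - b ^ 2) * B ^ 2 := by rw [← h2]; field_simp
    rw [h1, hζ₁, hϑ₁]
    field_simp
    linear_combination -q * h3
  clear hB hb
  simp only [Matrix.cons_val_zero, Matrix.cons_val_one, Matrix.cons_val, hY, hZ₀, hZ₁]
  -- This is the derivative of the relation `hωsq`, with b' = −τ s'.
  have hE : 2 * ω * ω₁ = 2 * ρ * ρ₁ / B ^ 2 - κ * ρ ^ 3 * ρ₁ / B ^ 3 - 2 * b * τ * s₁ := by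
    rw [hω₁, hD, hs₁, ha, hκ]
    field_simp
    ring
  have hA : ζ₂ + a * ϑ₂ - τ * ρ * (ϑ₂ * ρ + ϑ₁ * ρ₁ + ϑ₁ * ρ₁) / B
      = q₁ / ω - q * ω₁ / ω ^ 2 - τ * κ * ρ ^ 3 * ρ₁ * ϑ₁ / (2 * B ^ 2) := by
    clear hY hD hω₁ hqsq hs₂ hZ₀ hZ₁ hZ₂
    rw [hϑ₂, hζ₂, hϑ₁, ha]
    rw [hs₁] at hE ⊢
    rw [hκ] at hE ⊢
    linear_combination (norm := skip)
      ((4 * (B - 1) / ρ ^ 2 * B * ρ * ρ₁ * q + B ^ 2 * q₁) / (ρ ^ 2 * ω)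
        - B ^ 2 * q * (2 * ρ * ρ₁ * ω + ρ ^ 2 * ω₁) / (ρ ^ 2 * ω) ^ 2) * hωsq
      + B ^ 2 * q / (ρ ^ 2 * ω) * hE
    field_simp
    ring
  rw [hA, hϑ₂, hω₁, hϑ₁, hs₂, hs₁, hκ]
  rw [hκ, ha] at hD
  have hD' : D = (2 - B) / B - 2 * τ * b := by rw [hD]; field_simp; ring
  rw [hD']
  -- After the substitutions the two sides differ by a combination of the relations for q² and ω²;
  -- the coefficients reduce the powers of q and b.
  linear_combination (norm := skip)
    (q / ω ^ 2 * (-(b ^ 2 * B ^ 4 / ρ ^ 4) + 2 * (B - 1) * b ^ 2 * B ^ 3 / ρ ^ 4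
      - 2 * τ * b * B ^ 2 / ρ ^ 2)) * hqsq
    + ((q * ρ₂ / ρ - 2 * (B - 1) / ρ ^ 2 * ρ₁ ^ 2 * q / B
      + B ^ 2 / (2 * ρ ^ 2) * (q₁ * (2 * ρ * ρ₁ / B ^ 2) + q * (2 - 4 * (B - 1) / B
        - (2 * (ρ₁ ^ 2 + ρ * ρ₂) / B ^ 2 - 8 * (B - 1) * ρ₁ ^ 2 / B ^ 3))))
      - q * ρ₁ ^ 2 * ((2 - B) / B - 2 * τ * b) / (B ^ 2 * ω ^ 2)) / ω ^ 2 * hωsq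
  field_simp
  ring

theorem bcvMetric_axis_smul {κ : ℝ} (τ ρ z k : ℝ) (X Z : Fin 3 → ℝ) :
    bcvMetric κ τ ![ρ, 0, z] X (k • Z) = k * bcvMetric κ τ ![ρ, 0, z] X Z := by
  rw [bcvMetric_axis τ rfl, bcvMetric_axis τ rfl]
  simp only [Pi.smul_apply, smul_eq_mul]
  ring

theorem bcvMetric_smul_add_smul (κ τ c d : ℝ) (p X Y Z : Fin 3 → ℝ) :
    bcvMetric κ τ p X (c • Y + d • Z) = c * bcvMetric κ τ p X Y + d * bcvMetric κ τ p X Z := by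
  simp only [bcvMetric, Pi.add_apply, Pi.smul_apply, smul_eq_mul]
  ring

theorem bcvMetric_comm (κ τ : ℝ) (p X Y : Fin 3 → ℝ) :
    bcvMetric κ τ p X Y = bcvMetric κ τ p Y X := by
  simp only [bcvMetric]
  ring

theorem christoffelFirst_bcvMetric_axis_smul {κ : ℝ} (τ z k : ℝ) {ρ : ℝ}
    (hB0 : 1 + κ / 4 * ρ ^ 2 ≠ 0) (X Z : Fin 3 → ℝ) :
    christoffelFirst (bcvMetric κ τ) ![ρ, 0, z] X X (k • Z)
      = k * christoffelFirst (bcvMetric κ τ) ![ρ, 0, z] X X Z := by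
  rw [christoffelFirst_bcvMetric_axis τ rfl hB0, christoffelFirst_bcvMetric_axis τ rfl hB0]
  simp only [Pi.smul_apply, smul_eq_mul]
  ring

/-- A helicoidal surface in Bour coordinates has vanishing mean curvature at a point if and only if
the function `s = ρ² / B` satisfies a second order relation there. Here `ρ` is the radius, `ω` the
norm of the Killing field generating the helicoidal motions, and `q = √R / B`. -/
theorem meanCurvature_eq_zero_iff {κ τ m a ρ z B b ρ₁ ρ₂ q q₁ ω ω₁ ϑ₁ ϑ₂ ζ₁ ζ₂ s₁ s₂ D φ : ℝ}
    (hm : m ≠ 0) (hρ : ρ ≠ 0)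
    (hω : ω ≠ 0) (hB : B = 1 + κ / 4 * ρ ^ 2) (hB0 : B ≠ 0) (hb : b = a - τ * ρ ^ 2 / B)
    (hωsq : ω ^ 2 = ρ ^ 2 / B ^ 2 + b ^ 2)
    (hqsq : q ^ 2 = ρ ^ 2 / B ^ 2 - ρ ^ 2 * ρ₁ ^ 2 / B ^ 4)
    (hD : D = 1 - 2 * a * τ + (4 * τ ^ 2 - κ) * ρ ^ 2 / (2 * B))
    (hω₁ : ω₁ = ρ * ρ₁ * D / (B ^ 2 * ω))
    (hs₁ : s₁ = 2 * ρ * ρ₁ / B ^ 2)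
    (hs₂ : s₂ = 2 * (ρ₁ ^ 2 + ρ * ρ₂) / B ^ 2 - 2 * κ * ρ ^ 2 * ρ₁ ^ 2 / B ^ 3)
    (hϑ₁ : ϑ₁ = -(b * B ^ 2 * q / (ρ ^ 2 * ω)))
    (hϑ₂ : ϑ₂ = -(((-τ * s₁) * B ^ 2 * q + b * B * (κ * ρ * ρ₁) * q + b * B ^ 2 * q₁) / (ρ ^ 2 * ω))
      + b * B ^ 2 * q * (2 * ρ * ρ₁ * ω + ρ ^ 2 * ω₁) / (ρ ^ 2 * ω) ^ 2)
    (hζ₁ : ζ₁ = ω * B ^ 2 * q / ρ ^ 2)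
    (hζ₂ : ζ₂ = (ω₁ * B ^ 2 * q + ω * B * (κ * ρ * ρ₁) * q + ω * B ^ 2 * q₁) / ρ ^ 2
      - 2 * ω * B ^ 2 * q * ρ₁ / ρ ^ 3)
    {Ψ : ℝ × ℝ → Fin 3 → ℝ} {x : ℝ × ℝ} (hΨ : Ψ x = rotZ φ ![ρ, 0, z])
    (hu : partialU Ψ x = rotZ φ ![ρ₁, ϑ₁ * ρ, ζ₁ + a * ϑ₁])
    (ht : partialT Ψ x = rotZ φ ![0, ρ / m, a / m])
    (huu : partialU (partialU Ψ) x
      = rotZ φ ![ρ₂ - ϑ₁ * (ϑ₁ * ρ), ϑ₂ * ρ + ϑ₁ * ρ₁ + ϑ₁ * ρ₁, ζ₂ + a * ϑ₂])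
    (htt : partialT (partialT Ψ) x = rotZ φ ![-(ρ / m ^ 2), 0, 0]) :
    LinearIndependent ℝ ![partialU Ψ x, partialT Ψ x] ∧
    ((∀ ν, IsUnitNormal (bcvMetric κ τ) Ψ x ν → meanCurvature (bcvMetric κ τ) Ψ x ν = 0) ↔
      q₁ * s₁ + q * (2 - κ * ρ ^ 2 / B - s₂) = 0) := by
  have hrel : ρ ^ 2 = (ω ^ 2 - b ^ 2) * B ^ 2 := by
    rw [show ω ^ 2 - b ^ 2 = ρ ^ 2 / B ^ 2 by linarith]; field_simp
  -- In the orthonormal coframe dx/B, dy/B, dz − τρ dy/B, put e_r = (1, 0, 0) and e' = (0, −b/ω,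
  -- ρ/(Bω)), which form an orthonormal basis of the complement of K. The two squared numbers are
  -- the e' and e_r components of Ψ_u.
  have hunit : (q * B / ρ) ^ 2 + (ρ₁ / B) ^ 2 = 1 := by
    rw [div_pow, mul_pow, hqsq]; field_simp; ring
  have hY : ζ₁ + a * ϑ₁ - τ * ρ * (ϑ₁ * ρ) / B = q / ω := by
    have h1 : ζ₁ + a * ϑ₁ - τ * ρ * (ϑ₁ * ρ) / B = ζ₁ + b * ϑ₁ := by rw [hb]; ring
    rw [h1, hζ₁, hϑ₁]
    field_simp
    linear_combination -q * hrel
  have hb' : a / m - τ * ρ * (ρ / m) / B = b / m := by rw [hb]; ring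
  have hX : ϑ₁ * ρ = -(b * B ^ 2 * q / (ρ * ω)) := by rw [hϑ₁]; field_simp
  have hE : bcvMetric κ τ ![ρ, 0, z] ![ρ₁, ϑ₁ * ρ, ζ₁ + a * ϑ₁] ![ρ₁, ϑ₁ * ρ, ζ₁ + a * ϑ₁] = 1 := by
    rw [bcvMetric_axis τ hB]
    simp only [Matrix.cons_val_zero, Matrix.cons_val_one, Matrix.cons_val, hY]
    simp only [hX]
    rw [← hunit]
    field_simp
    linear_combination (q ^ 2 * B ^ 2) * hrel
  have hF : bcvMetric κ τ ![ρ, 0, z] ![ρ₁, ϑ₁ * ρ, ζ₁ + a * ϑ₁] ![0, ρ / m, a / m] = 0 := by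
    rw [bcvMetric_axis τ hB]
    simp only [Matrix.cons_val_zero, Matrix.cons_val_one, Matrix.cons_val, hY, hb']
    simp only [hX]
    field_simp
    ring
  have hG : bcvMetric κ τ ![ρ, 0, z] ![0, ρ / m, a / m] ![0, ρ / m, a / m] = ω ^ 2 / m ^ 2 := by
    rw [bcvMetric_axis τ hB]
    simp only [Matrix.cons_val_zero, Matrix.cons_val_one, Matrix.cons_val, hb']
    rw [hωsq]
    field_simp
    ring
  -- Z is (qB/ρ) e_r − (ρ₁/B) e', that is, Ψ_u turned by a right angle in the complement of K.
  set Z : Fin 3 → ℝ :=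
    ![q * B ^ 2 / ρ, b * ρ₁ / ω, -(ρ₁ * ρ / (B ^ 2 * ω)) + τ * ρ * (b * ρ₁ / ω) / B] with hZ
  have hZ₂ : Z 2 - τ * ρ * Z 1 / B = -(ρ₁ * ρ / (B ^ 2 * ω)) := by simp [hZ]
  have hB0' : 1 + κ / 4 * ρ ^ 2 ≠ 0 := hB ▸ hB0
  have hBp : bcvB κ ![ρ, 0, z] ≠ 0 := by simpa [bcvB] using hB0'
  -- Since F = 0, the mixed coefficient M never has to be computed. The D-term of L cancels against
  -- N/G, leaving only the expression in s and q.
  have hmean (k : ℝ) : meanCurvature (bcvMetric κ τ) Ψ x (rotZ φ (k • Z))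
      = k * (-(B ^ 2 / (4 * ρ ^ 2)) * (q₁ * s₁ + q * (2 - κ * ρ ^ 2 / B - s₂))) := by
    simp only [meanCurvature]
    rw [hu, ht, huu, htt, hΨ]
    simp only [bcvMetric_rotZ, christoffelFirst_bcvMetric_rotZ τ φ hBp, hE, hF, hG,
      bcvMetric_axis_smul, christoffelFirst_bcvMetric_axis_smul τ z k hB0', ← mul_add]
    rw [secondForm_uu hρ hω hB hB0 hb hωsq hqsq hD hω₁ hs₁ hs₂ hϑ₁ hϑ₂ hζ₁ hζ₂ Z rfl rfl hZ₂,
      secondForm_tt hm hB hB0, ← hD]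
    simp only [hZ, Matrix.cons_val_zero]
    field_simp
    ring
  refine ⟨?_, fun h => ?_, fun h ν hν => ?_⟩
  · rw [LinearIndependent.pair_iff]
    intro c d hcd
    have h0 (V : Fin 3 → ℝ) : bcvMetric κ τ (rotZ φ ![ρ, 0, z]) V 0 = 0 := by simp [bcvMetric]
    have h1 := h0 (partialU Ψ x)
    have h2 := h0 (partialT Ψ x)
    rw [← hcd, bcvMetric_smul_add_smul, hu, ht, bcvMetric_rotZ, bcvMetric_rotZ, hE, hF] at h1
    rw [← hcd, bcvMetric_smul_add_smul, hu, ht, bcvMetric_rotZ, bcvMetric_rotZ, bcvMetric_comm, hF,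
      hG] at h2
    have hω2 : ω ^ 2 / m ^ 2 ≠ 0 := by positivity
    exact ⟨by linarith, by simpa [hω2] using h2⟩
  · have hn : IsUnitNormal (bcvMetric κ τ) Ψ x (rotZ φ ((1 : ℝ) • Z)) := by
      rw [one_smul, IsUnitNormal, hu, ht, hΨ, bcvMetric_rotZ, bcvMetric_rotZ, bcvMetric_rotZ,
        bcvMetric_axis τ hB, bcvMetric_axis τ hB, bcvMetric_axis τ hB, hZ₂]
      simp only [hZ, Matrix.cons_val_zero, Matrix.cons_val_one, Matrix.cons_val, hY, hb']
      simp only [hX]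
      refine ⟨?_, ?_, ?_⟩
      · rw [← hunit]
        field_simp
        linear_combination (ρ ^ 2 * ρ₁ ^ 2) * hrel
      · field_simp
        linear_combination (-q * ρ₁) * hrel
      · field_simp
        ring
    have h1 := h _ hn
    rw [hmean, one_mul] at h1
    exact (mul_eq_zero.1 h1).resolve_left (neg_ne_zero.2 (by positivity))
  · obtain ⟨-, h1, h2⟩ := hν
    have hsurj := rotZ_neg_cancel φ ν
    set W := rotZ (-φ) ν with hW
    rw [← hsurj, hu, hΨ, bcvMetric_rotZ, bcvMetric_axis τ hB] at h1
    rw [← hsurj, ht, hΨ, bcvMetric_rotZ, bcvMetric_axis τ hB] at h2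
    simp only [Matrix.cons_val_zero, Matrix.cons_val_one, Matrix.cons_val, hY, hb'] at h1 h2
    simp only [hX] at h1
    obtain ⟨Y₂, hY₂⟩ : ∃ y, y = W 2 - τ * ρ * W 1 / B := ⟨_, rfl⟩
    rw [← hY₂] at h1 h2
    -- β is the component of `W` along e'. Orthogonality to K and Ψ_u will give W = g(W, Z) Z, and
    -- g(W, Z) is the scalar appearing in `hk`.
    obtain ⟨β, hβ⟩ : ∃ β, β = ρ / B * Y₂ / ω - b * W 1 / (B * ω) := ⟨_, rfl⟩
    have h3 : ρ * W 1 + b * B ^ 2 * Y₂ = 0 := by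
      field_simp at h2
      linear_combination h2
    have hW₁ : W 1 = -(B * b * β / ω) := by
      rw [hβ]
      linear_combination (norm := skip) (W 1 / ω ^ 2) * hωsq + ρ / (B ^ 2 * ω ^ 2) * h3
      field_simp
      ring
    have hWY : Y₂ = β * ρ / (B * ω) := by
      rw [hβ]
      linear_combination (norm := skip) (Y₂ / ω ^ 2) * hωsq + b / (B ^ 2 * ω ^ 2) * h3
      field_simp
      ring
    have hW0 : W 0 * ρ₁ / B ^ 2 + β * (q * B / ρ) = 0 := by
      rw [hWY, hW₁] at h1
      linear_combination (norm := skip) h1 + β * q * B / (ρ * ω ^ 2) * hωsq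
      field_simp
      ring
    have hk₁ : W 1 = (W 0 / B * (q * B / ρ) - β * (ρ₁ / B)) * (b * ρ₁ / ω) := by
      rw [hW₁]
      linear_combination (norm := skip) (B * b / ω) * (-(q * B / ρ) * hW0 + β * hunit)
      field_simp
      ring
    have hk : W = (W 0 / B * (q * B / ρ) - β * (ρ₁ / B)) • Z := by
      ext i
      fin_cases i
      · simp only [hZ, Pi.smul_apply, smul_eq_mul, Fin.zero_eta, Matrix.cons_val_zero]
        linear_combination (norm := skip) -W 0 * hunit + ρ₁ * hW0
        field_simp
        ring
      · simpa [hZ] using hk₁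
      · have h4 : W 2 = Y₂ + τ * ρ * W 1 / B := by rw [hY₂]; ring
        simp only [hZ, Pi.smul_apply, smul_eq_mul, Fin.reduceFinMk, Matrix.cons_val]
        rw [h4, hWY]
        linear_combination (norm := skip)
          -(ρ / (B * ω)) * (-(q * B / ρ) * hW0 + β * hunit) + τ * ρ / B * hk₁
        field_simp
        ring
    rw [← hsurj, hk, hmean, h, mul_zero, mul_zero]

/-! ### The profile curve of a surface of the Bour family -/

/-- The value of `B = 1 + (κ/4) r²` along the profile curve. -/
noncomputable def bourB (κ τ m a : ℝ) (U : ℝ → ℝ) (u : ℝ) : ℝ :=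
  1 + κ / 4 * bourXi1 κ τ m a U u ^ 2

/-- The function `s = ξ₁² / B` along the profile curve. -/
noncomputable def bourS (κ τ m a : ℝ) (U : ℝ → ℝ) (u : ℝ) : ℝ :=
  bourXi1 κ τ m a U u ^ 2 / bourB κ τ m a U u

/-- The conserved quantity `√R / B` of minimal surfaces in the Bour family. -/
noncomputable def bourMomentum (κ τ m a : ℝ) (U : ℝ → ℝ) (u : ℝ) : ℝ :=
  Real.sqrt (bourRadicand κ τ m a U u) / bourB κ τ m a U u

theorem ContDiffOn.hasDerivAt_deriv_deriv {f : ℝ → ℝ} {I : Set ℝ} (hf : ContDiffOn ℝ 2 f I)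
    (hI : IsOpen I) {u : ℝ} (hu : u ∈ I) :
    HasDerivAt f (deriv f u) u ∧ HasDerivAt (deriv f) (deriv (deriv f) u) u := by
  have h : ContDiffOn ℝ (1 + 1) f I := by simpa [one_add_one_eq_two] using hf
  rw [contDiffOn_succ_iff_deriv_of_isOpen hI] at h
  exact ⟨((h.1 u hu).differentiableAt (hI.mem_nhds hu)).hasDerivAt,
    ((h.2.2.differentiableOn one_ne_zero u hu).differentiableAt (hI.mem_nhds hu)).hasDerivAt⟩

theorem bourXi1_sq {κ τ m a : ℝ} {U : ℝ → ℝ} {u : ℝ} (hQ : 0 < bourQuotient κ τ m a U u) :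
    bourXi1 κ τ m a U u ^ 2 = 4 * bourQuotient κ τ m a U u := by
  rw [bourXi1, mul_pow, Real.sq_sqrt hQ.le]
  norm_num

/-- Let d be the denominator of the quotient Q defining ξ₁² = 4Q. Then Qd = m²U² − a² and Bd = 2(1 +
√Δ − 2aτ), so d cancels from s = 4Q/B. -/
theorem bourS_mul {κ τ m a : ℝ} {U : ℝ → ℝ} {u : ℝ} (hΔ : 0 < bourDelta κ τ m a U u)
    (hQ : 0 < bourQuotient κ τ m a U u) (hB : 0 < bourB κ τ m a U u) :
    1 + Real.sqrt (bourDelta κ τ m a U u) - 2 * a * τ ≠ 0 ∧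
      bourS κ τ m a U u * (1 + Real.sqrt (bourDelta κ τ m a U u) - 2 * a * τ)
        = 2 * (m ^ 2 * U u ^ 2 - a ^ 2) := by
  have hD := Real.sq_sqrt hΔ.le
  rw [bourS]
  have hB' : bourB κ τ m a U u = 1 + κ * bourQuotient κ τ m a U u := by
    rw [bourB, bourXi1_sq hQ]; ring
  rw [bourXi1_sq hQ]
  set D := Real.sqrt (bourDelta κ τ m a U u)
  set B := bourB κ τ m a U u
  rw [bourDelta] at hD
  have hden : (1 + D) ^ 2 - 4 * τ ^ 2 * m ^ 2 * U u ^ 2 ≠ 0 := by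
    intro h
    simp [bourQuotient, D, h] at hQ
  have hq : bourQuotient κ τ m a U u * ((1 + D) ^ 2 - 4 * τ ^ 2 * m ^ 2 * U u ^ 2)
      = m ^ 2 * U u ^ 2 - a ^ 2 := by
    rw [bourQuotient]
    exact div_mul_cancel₀ _ hden
  set Q := bourQuotient κ τ m a U u
  have h1 : B * ((1 + D) ^ 2 - 4 * τ ^ 2 * m ^ 2 * U u ^ 2) = 2 * (1 + D - 2 * a * τ) := by
    rw [hB']
    linear_combination κ * hq + hD
  constructor
  · intro h
    rw [h, mul_zero] at h1
    exact (mul_ne_zero hB.ne' hden) h1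
  · have := hB.ne'
    rw [div_mul_eq_mul_div, div_eq_iff this]
    linear_combination 2 * B * hq - 2 * Q * h1

/-- The definition of Δ factors (√Δ − (1 − 2aτ))(√Δ + (1 − 2aτ)). The second factor is nonzero and
can be cancelled against `bourS_mul`; this removes the square root from all later computations. -/
theorem sqrt_bourDelta {κ τ m a : ℝ} {U : ℝ → ℝ} {u : ℝ} (hΔ : 0 < bourDelta κ τ m a U u)
    (hQ : 0 < bourQuotient κ τ m a U u) (hB : 0 < bourB κ τ m a U u) :
    Real.sqrt (bourDelta κ τ m a U u)
      = 1 - 2 * a * τ + (4 * τ ^ 2 - κ) * bourS κ τ m a U u / 2 := by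
  obtain ⟨h0, h1⟩ := bourS_mul hΔ hQ hB
  have hD := Real.sq_sqrt hΔ.le
  set D := Real.sqrt (bourDelta κ τ m a U u)
  rw [bourDelta] at hD
  refine mul_left_cancel₀ h0 ?_
  linear_combination hD - (4 * τ ^ 2 - κ) / 2 * h1

namespace BourAdmissible

variable {κ τ m a : ℝ} {U : ℝ → ℝ} {I : Set ℝ}

theorem bourXi1_pos (hU : BourAdmissible κ τ m a U I) {u : ℝ} (hu : u ∈ I) :
    0 < bourXi1 κ τ m a U u :=
  mul_pos two_pos (Real.sqrt_pos.2 (hU.quotient_pos u hu))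

theorem bourB_pos (hU : BourAdmissible κ τ m a U I) {u : ℝ} (hu : u ∈ I) :
    0 < bourB κ τ m a U u := hU.B_pos u hu

theorem bourS_pos (hU : BourAdmissible κ τ m a U I) {u : ℝ} (hu : u ∈ I) :
    0 < bourS κ τ m a U u :=
  div_pos (pow_pos (hU.bourXi1_pos hu) 2) (hU.bourB_pos hu)

theorem inv_bourB (hU : BourAdmissible κ τ m a U I) {u : ℝ} (hu : u ∈ I) :
    (bourB κ τ m a U u)⁻¹ = 1 - κ / 4 * bourS κ τ m a U u := by
  have h := (hU.bourB_pos hu).ne'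
  rw [bourS]
  field_simp
  rw [bourB]
  ring

theorem kappa_mul_bourS_lt (hU : BourAdmissible κ τ m a U I) {u : ℝ} (hu : u ∈ I) :
    κ * bourS κ τ m a U u < 4 := by
  have h := inv_pos.2 (hU.bourB_pos hu)
  rw [hU.inv_bourB hu] at h
  linarith

theorem sqrt_delta (hU : BourAdmissible κ τ m a U I) {u : ℝ} (hu : u ∈ I) :
    Real.sqrt (bourDelta κ τ m a U u)
      = 1 - 2 * a * τ + (4 * τ ^ 2 - κ) * bourS κ τ m a U u / 2 :=
  sqrt_bourDelta (hU.delta_pos u hu) (hU.quotient_pos u hu) (hU.bourB_pos hu)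

theorem delta_root_pos (hU : BourAdmissible κ τ m a U I) {u : ℝ} (hu : u ∈ I) :
    0 < 1 - 2 * a * τ + (4 * τ ^ 2 - κ) * bourS κ τ m a U u / 2 := by
  rw [← hU.sqrt_delta hu]
  exact Real.sqrt_pos.2 (hU.delta_pos u hu)

theorem mul_U_sq (hU : BourAdmissible κ τ m a U I) {u : ℝ} (hu : u ∈ I) :
    m ^ 2 * U u ^ 2 = a ^ 2 + bourS κ τ m a U u * (1 - 2 * a * τ)
      + bourS κ τ m a U u ^ 2 * (4 * τ ^ 2 - κ) / 4 := by
  have h := (bourS_mul (hU.delta_pos u hu) (hU.quotient_pos u hu) (hU.bourB_pos hu)).2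
  rw [hU.sqrt_delta hu] at h
  linarith

theorem contDiffOn_bourXi1 (hU : BourAdmissible κ τ m a U I) :
    ContDiffOn ℝ 2 (bourXi1 κ τ m a U) I := by
  have h1 := hU.contDiffOn
  have hΔ : ContDiffOn ℝ 2 (bourDelta κ τ m a U) I := by
    unfold bourDelta
    fun_prop
  have hD := hΔ.sqrt fun u hu => (hU.delta_pos u hu).ne'
  have hQ : ContDiffOn ℝ 2 (bourQuotient κ τ m a U) I := by
    refine ContDiffOn.div (by fun_prop) (by fun_prop) fun u hu h => ?_
    have h2 := hU.quotient_pos u hu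
    simp [bourQuotient, h] at h2
  exact contDiffOn_const.mul (hQ.sqrt fun u hu => (hU.quotient_pos u hu).ne')

theorem contDiffOn_bourB (hU : BourAdmissible κ τ m a U I) :
    ContDiffOn ℝ 2 (bourB κ τ m a U) I := by
  have h := hU.contDiffOn_bourXi1
  unfold bourB
  fun_prop

theorem contDiffOn_bourS (hU : BourAdmissible κ τ m a U I) :
    ContDiffOn ℝ 2 (bourS κ τ m a U) I :=
  (hU.contDiffOn_bourXi1.pow 2).div hU.contDiffOn_bourB fun _ hu => (hU.bourB_pos hu).ne'

theorem hasDerivAt_bourB (hU : BourAdmissible κ τ m a U I) (hI : IsOpen I) {u : ℝ} (hu : u ∈ I) :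
    HasDerivAt (bourB κ τ m a U)
      (κ / 2 * bourXi1 κ τ m a U u * deriv (bourXi1 κ τ m a U) u) u :=
  ((((hU.contDiffOn_bourXi1.hasDerivAt_deriv_deriv hI hu).1.fun_pow 2).const_mul
    (κ / 4)).const_add 1).congr_deriv (by simp; ring)

theorem hasDerivAt_bourS (hU : BourAdmissible κ τ m a U I) (hI : IsOpen I) {u : ℝ} (hu : u ∈ I) :
    HasDerivAt (bourS κ τ m a U)
      (2 * bourXi1 κ τ m a U u * deriv (bourXi1 κ τ m a U) u / bourB κ τ m a U u ^ 2) u := by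
  have hB := (hU.bourB_pos hu).ne'
  refine (((hU.contDiffOn_bourXi1.hasDerivAt_deriv_deriv hI hu).1.fun_pow 2).fun_div
    (hU.hasDerivAt_bourB hI hu) hB).congr_deriv ?_
  have h : κ * bourXi1 κ τ m a U u ^ 2 = 4 * (bourB κ τ m a U u - 1) := by rw [bourB]; ring
  field_simp
  simp
  linear_combination (-(bourXi1 κ τ m a U u * deriv (bourXi1 κ τ m a U) u)) * h

theorem deriv_bourS (hU : BourAdmissible κ τ m a U I) (hI : IsOpen I) {u : ℝ} (hu : u ∈ I) :
    deriv (bourS κ τ m a U) u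
      = 2 * bourXi1 κ τ m a U u * deriv (bourXi1 κ τ m a U) u / bourB κ τ m a U u ^ 2 :=
  (hU.hasDerivAt_bourS hI hu).deriv

theorem deriv_deriv_bourS (hU : BourAdmissible κ τ m a U I) (hI : IsOpen I) {u : ℝ}
    (hu : u ∈ I) :
    deriv (deriv (bourS κ τ m a U)) u
      = 2 * (deriv (bourXi1 κ τ m a U) u ^ 2
          + bourXi1 κ τ m a U u * deriv (deriv (bourXi1 κ τ m a U)) u) / bourB κ τ m a U u ^ 2
        - 2 * κ * bourXi1 κ τ m a U u ^ 2 * deriv (bourXi1 κ τ m a U) u ^ 2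
          / bourB κ τ m a U u ^ 3 := by
  have hB := (hU.bourB_pos hu).ne'
  obtain ⟨h1, h2⟩ := hU.contDiffOn_bourXi1.hasDerivAt_deriv_deriv hI hu
  have heq : deriv (bourS κ τ m a U) =ᶠ[nhds u] fun u =>
      2 * bourXi1 κ τ m a U u * deriv (bourXi1 κ τ m a U) u / bourB κ τ m a U u ^ 2 :=
    Filter.eventuallyEq_of_mem (hI.mem_nhds hu) fun v hv => hU.deriv_bourS hI hv
  rw [heq.deriv_eq]
  refine ((((h1.const_mul 2).fun_mul h2).fun_div ((hU.hasDerivAt_bourB hI hu).fun_pow 2)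
    (pow_ne_zero 2 hB)).congr_deriv ?_).deriv
  field_simp
  simp
  ring

theorem hasDerivAt_mul_U (hU : BourAdmissible κ τ m a U I) (hI : IsOpen I) {u : ℝ} (hu : u ∈ I) :
    HasDerivAt (fun v => m * U v)
      (bourXi1 κ τ m a U u * deriv (bourXi1 κ τ m a U) u
        * (1 - 2 * a * τ + (4 * τ ^ 2 - κ) * bourS κ τ m a U u / 2)
        / (bourB κ τ m a U u ^ 2 * (m * U u))) u := by
  have h1 := (hU.contDiffOn.hasDerivAt_deriv_deriv hI hu).1
  have hs := hU.hasDerivAt_bourS hI hu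
  have h2 := ((h1.fun_pow 2).const_mul (m ^ 2))
  have h3 := ((hs.mul_const (1 - 2 * a * τ)).const_add (a ^ 2)).fun_add
    ((((hs.fun_pow 2).mul_const (4 * τ ^ 2 - κ))).div_const 4)
  have heq : (fun v => m ^ 2 * U v ^ 2) =ᶠ[nhds u] fun v => a ^ 2
      + bourS κ τ m a U v * (1 - 2 * a * τ) + bourS κ τ m a U v ^ 2 * (4 * τ ^ 2 - κ) / 4 :=
    Filter.eventuallyEq_of_mem (hI.mem_nhds hu) fun v hv => hU.mul_U_sq hv
  have h4 := (h3.congr_of_eventuallyEq heq).unique h2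
  refine (h1.const_mul m).congr_deriv ?_
  have hm := hU.m_ne_zero
  have hp := (hU.pos u hu).ne'
  have hB := (hU.bourB_pos hu).ne'
  simp only [Nat.cast_ofNat, Nat.add_one_sub_one, pow_one] at h4
  rw [eq_div_iff (by positivity)]
  field_simp at h4
  linear_combination (-1 / 4) * h4

/-- Differentiating the polynomial for m²U² gives m²UU' = ξ₁ξ₁'√Δ/B², so the Δ in the denominator of
R cancels. -/
theorem radicand_eq (hU : BourAdmissible κ τ m a U I) (hI : IsOpen I) {u : ℝ} (hu : u ∈ I) :
    bourRadicand κ τ m a U u = bourXi1 κ τ m a U u ^ 2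
      - bourXi1 κ τ m a U u ^ 2 * deriv (bourXi1 κ τ m a U) u ^ 2 / bourB κ τ m a U u ^ 2 := by
  have h1 := (hU.hasDerivAt_mul_U hI hu).unique
    ((hU.contDiffOn.hasDerivAt_deriv_deriv hI hu).1.const_mul m)
  have hD := hU.delta_root_pos hu
  rw [← hU.sqrt_delta hu] at h1 hD
  have hΔ := Real.sq_sqrt (hU.delta_pos u hu).le
  have hm := hU.m_ne_zero
  have hp := (hU.pos u hu).ne'
  have hB := (hU.bourB_pos hu).ne'
  have h4 : 4 + κ * bourXi1 κ τ m a U u ^ 2 = 4 * bourB κ τ m a U u := by rw [bourB]; ring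
  rw [bourRadicand, ← hΔ, h4]
  have h5 : m ^ 4 * U u ^ 2 * deriv U u ^ 2 = (m * U u * (m * deriv U u)) ^ 2 := by ring
  rw [h5, ← h1]
  field_simp
  ring

theorem bourMomentum_sq (hU : BourAdmissible κ τ m a U I) (hI : IsOpen I) {u : ℝ} (hu : u ∈ I) :
    bourMomentum κ τ m a U u ^ 2 = bourXi1 κ τ m a U u ^ 2 / bourB κ τ m a U u ^ 2
      - bourXi1 κ τ m a U u ^ 2 * deriv (bourXi1 κ τ m a U) u ^ 2 / bourB κ τ m a U u ^ 4 := by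
  have hB := (hU.bourB_pos hu).ne'
  rw [bourMomentum, div_pow, Real.sq_sqrt (hU.radicand_nonneg u hu), hU.radicand_eq hI hu]
  field_simp

theorem bourMomentum_nonneg (hU : BourAdmissible κ τ m a U I) {u : ℝ} (hu : u ∈ I) :
    0 ≤ bourMomentum κ τ m a U u :=
  div_nonneg (Real.sqrt_nonneg _) (hU.bourB_pos hu).le

theorem bourMomentum_sq_eq_bourS (hU : BourAdmissible κ τ m a U I) (hI : IsOpen I) {u : ℝ}
    (hu : u ∈ I) :
    bourMomentum κ τ m a U u ^ 2 = bourS κ τ m a U u - κ / 4 * bourS κ τ m a U u ^ 2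
      - deriv (bourS κ τ m a U) u ^ 2 / 4 := by
  have h1 : bourS κ τ m a U u - κ / 4 * bourS κ τ m a U u ^ 2
      = bourXi1 κ τ m a U u ^ 2 / bourB κ τ m a U u ^ 2 := by
    rw [show bourS κ τ m a U u - κ / 4 * bourS κ τ m a U u ^ 2
      = bourS κ τ m a U u * (1 - κ / 4 * bourS κ τ m a U u) by ring, ← hU.inv_bourB hu, bourS]
    ring
  rw [h1, hU.bourMomentum_sq hI hu, hU.deriv_bourS hI hu]
  ring

theorem mul_U_sq_eq (hU : BourAdmissible κ τ m a U I) {u : ℝ} (hu : u ∈ I) :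
    (m * U u) ^ 2 = bourXi1 κ τ m a U u ^ 2 / bourB κ τ m a U u ^ 2
      + (a - τ * bourXi1 κ τ m a U u ^ 2 / bourB κ τ m a U u) ^ 2 := by
  have h1 : bourXi1 κ τ m a U u ^ 2 / bourB κ τ m a U u ^ 2
      = bourS κ τ m a U u * (1 - κ / 4 * bourS κ τ m a U u) := by
    rw [← hU.inv_bourB hu, bourS]
    ring
  rw [h1, mul_div_assoc, ← bourS, mul_pow, hU.mul_U_sq hu]
  ring

theorem xi2Integrand_eq (hU : BourAdmissible κ τ m a U I) {u : ℝ} (hu : u ∈ I) :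
    bourXi2Integrand κ τ m a U u
      = m * U u * bourB κ τ m a U u ^ 2 * bourMomentum κ τ m a U u
        / bourXi1 κ τ m a U u ^ 2 := by
  have hB := (hU.bourB_pos hu).ne'
  have h4 : 4 + κ * bourXi1 κ τ m a U u ^ 2 = 4 * bourB κ τ m a U u := by rw [bourB]; ring
  rw [bourXi2Integrand, h4, bourMomentum]
  field_simp

theorem thetaIntegrand_eq (hU : BourAdmissible κ τ m a U I) {u : ℝ} (hu : u ∈ I) :
    bourThetaIntegrand κ τ m a U u
      = -((a - τ * bourXi1 κ τ m a U u ^ 2 / bourB κ τ m a U u) * bourB κ τ m a U u ^ 2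
        * bourMomentum κ τ m a U u / (bourXi1 κ τ m a U u ^ 2 * (m * U u))) := by
  have hB := (hU.bourB_pos hu).ne'
  have h4 : (4 * τ - a * κ) * bourXi1 κ τ m a U u ^ 2 - 4 * a
      = -4 * ((a - τ * bourXi1 κ τ m a U u ^ 2 / bourB κ τ m a U u) * bourB κ τ m a U u) := by
    rw [sub_mul a, div_mul_cancel₀ _ hB, bourB]; ring
  rw [bourThetaIntegrand, h4, bourMomentum]
  have hm := hU.m_ne_zero
  have hp := (hU.pos u hu).ne'
  have hx := (hU.bourXi1_pos hu).ne'
  field_simp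

end BourAdmissible

theorem bourSurface_eq_rotZ (κ τ m a : ℝ) (U ξ₂ ϑ : ℝ → ℝ) (x : ℝ × ℝ) :
    bourSurface κ τ m a U ξ₂ ϑ x = rotZ (x.2 / m + ϑ x.1)
      ![bourXi1 κ τ m a U x.1, 0, ξ₂ x.1 + a * (x.2 / m + ϑ x.1)] := by
  ext i
  fin_cases i <;> simp [bourSurface, rotZ, mul_comm]

/-! ### Partial derivatives of a helicoidal surface -/

section Partials

variable {m a : ℝ} {ρ ϑ ζ ρ₁ ϑ₁ ζ₁ : ℝ → ℝ} {Ψ : ℝ × ℝ → Fin 3 → ℝ}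

theorem partialU_helicoidal
    (hΨ : ∀ x, Ψ x = rotZ (x.2 / m + ϑ x.1) ![ρ x.1, 0, ζ x.1 + a * (x.2 / m + ϑ x.1)])
    {r t z u : ℝ} (hρ : HasDerivAt ρ r u) (hϑ : HasDerivAt ϑ t u) (hζ : HasDerivAt ζ z u)
    (s : ℝ) : partialU Ψ (u, s) = rotZ (s / m + ϑ u) ![r, t * ρ u, z + a * t] := by
  have h := hasDerivAt_rotZ (hϑ.const_add (s / m)) hρ (hasDerivAt_const u (0 : ℝ))
    (hζ.fun_add ((hϑ.const_add (s / m)).const_mul a))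
  simp only [mul_zero, sub_zero, zero_add] at h
  rw [partialU, ← h.deriv]
  simp only [hΨ]

theorem partialT_helicoidal
    (hΨ : ∀ x, Ψ x = rotZ (x.2 / m + ϑ x.1) ![ρ x.1, 0, ζ x.1 + a * (x.2 / m + ϑ x.1)])
    (x : ℝ × ℝ) : partialT Ψ x = rotZ (x.2 / m + ϑ x.1) ![0, ρ x.1 / m, a / m] := by
  have hφ : HasDerivAt (fun s : ℝ => s / m + ϑ x.1) (1 / m) x.2 :=
    ((hasDerivAt_id x.2).div_const m).add_const _
  have h := hasDerivAt_rotZ hφ (hasDerivAt_const x.2 (ρ x.1)) (hasDerivAt_const x.2 (0 : ℝ))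
    ((hφ.const_mul a).const_add (ζ x.1))
  have e : rotZ (x.2 / m + ϑ x.1) ![0 - 1 / m * 0, 0 + 1 / m * ρ x.1, a * (1 / m)]
      = rotZ (x.2 / m + ϑ x.1) ![0, ρ x.1 / m, a / m] := by
    congr 3 <;> ring_nf
  rw [partialT, ← e, ← h.deriv]
  simp only [hΨ]

theorem partialT_partialT_helicoidal
    (hΨ : ∀ x, Ψ x = rotZ (x.2 / m + ϑ x.1) ![ρ x.1, 0, ζ x.1 + a * (x.2 / m + ϑ x.1)])
    (x : ℝ × ℝ) :
    partialT (partialT Ψ) x = rotZ (x.2 / m + ϑ x.1) ![-(ρ x.1 / m ^ 2), 0, 0] := by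
  have hφ : HasDerivAt (fun s : ℝ => s / m + ϑ x.1) (1 / m) x.2 :=
    ((hasDerivAt_id x.2).div_const m).add_const _
  have h := hasDerivAt_rotZ hφ (hasDerivAt_const x.2 (0 : ℝ))
    (hasDerivAt_const x.2 (ρ x.1 / m)) (hasDerivAt_const x.2 (a / m))
  have e : rotZ (x.2 / m + ϑ x.1) ![0 - 1 / m * (ρ x.1 / m), 0 + 1 / m * 0, 0]
      = rotZ (x.2 / m + ϑ x.1) ![-(ρ x.1 / m ^ 2), 0, 0] := by
    congr 3 <;> ring_nf
  rw [partialT, ← e, ← h.deriv]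
  simp only [partialT_helicoidal hΨ]

theorem partialU_partialU_helicoidal {I : Set ℝ} (hI : IsOpen I)
    (hΨ : ∀ x, Ψ x = rotZ (x.2 / m + ϑ x.1) ![ρ x.1, 0, ζ x.1 + a * (x.2 / m + ϑ x.1)])
    (hρ : ∀ u ∈ I, HasDerivAt ρ (ρ₁ u) u) (hϑ : ∀ u ∈ I, HasDerivAt ϑ (ϑ₁ u) u)
    (hζ : ∀ u ∈ I, HasDerivAt ζ (ζ₁ u) u) {r t z u : ℝ} (hu : u ∈ I)
    (hρ₁ : HasDerivAt ρ₁ r u) (hϑ₁ : HasDerivAt ϑ₁ t u) (hζ₁ : HasDerivAt ζ₁ z u) (s : ℝ) :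
    partialU (partialU Ψ) (u, s) = rotZ (s / m + ϑ u)
      ![r - ϑ₁ u * (ϑ₁ u * ρ u), t * ρ u + ϑ₁ u * ρ₁ u + ϑ₁ u * ρ₁ u, z + a * t] := by
  have h := hasDerivAt_rotZ ((hϑ u hu).const_add (s / m)) hρ₁ (hϑ₁.fun_mul (hρ u hu))
    (hζ₁.fun_add (hϑ₁.const_mul a))
  rw [partialU, ← h.deriv]
  refine Filter.EventuallyEq.deriv_eq (Filter.eventuallyEq_of_mem (hI.mem_nhds hu) fun v hv => ?_)
  exact partialU_helicoidal hΨ (hρ v hv) (hϑ v hv) (hζ v hv) s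

end Partials

/-! ### Minimality as a differential equation -/

section Minimality

variable {κ τ m a : ℝ} {U ξ₂ ϑ : ℝ → ℝ} {I : Set ℝ}

/-- Differentiability of √R/B is assumed here because the square root may fail to be smooth at zeros
of R. It comes from the regularity of Ψ in one direction of the classification and from constancy in
the other. -/
theorem BourAdmissible.meanCurvature_eq_zero_iff (hU : BourAdmissible κ τ m a U I) (hI : IsOpen I)
    (hξ₂ : ∀ u ∈ I, HasDerivAt ξ₂ (bourXi2Integrand κ τ m a U u) u)
    (hϑ : ∀ u ∈ I, HasDerivAt ϑ (bourThetaIntegrand κ τ m a U u) u) {u q₁ : ℝ} (hu : u ∈ I)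
    (hq : HasDerivAt (bourMomentum κ τ m a U) q₁ u) (t : ℝ) :
    LinearIndependent ℝ ![partialU (bourSurface κ τ m a U ξ₂ ϑ) (u, t),
      partialT (bourSurface κ τ m a U ξ₂ ϑ) (u, t)] ∧
    ((∀ ν, IsUnitNormal (bcvMetric κ τ) (bourSurface κ τ m a U ξ₂ ϑ) (u, t) ν →
        meanCurvature (bcvMetric κ τ) (bourSurface κ τ m a U ξ₂ ϑ) (u, t) ν = 0) ↔
      q₁ * deriv (bourS κ τ m a U) u + bourMomentum κ τ m a U u
        * (2 - κ * bourS κ τ m a U u - deriv (deriv (bourS κ τ m a U)) u) = 0) := by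
  have hm := hU.m_ne_zero
  have hx := (hU.bourXi1_pos hu).ne'
  have hB := (hU.bourB_pos hu).ne'
  have hω : m * U u ≠ 0 := mul_ne_zero hm (hU.pos u hu).ne'
  have hΨ := bourSurface_eq_rotZ κ τ m a U ξ₂ ϑ
  obtain ⟨hρ₁, hρ₂⟩ := hU.contDiffOn_bourXi1.hasDerivAt_deriv_deriv hI hu
  have hB₁ := hU.hasDerivAt_bourB hI hu
  have hω₁ := hU.hasDerivAt_mul_U hI hu
  set ρ := bourXi1 κ τ m a U u with hρ
  set ρ₁ := deriv (bourXi1 κ τ m a U) u with hρ₁'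
  set B := bourB κ τ m a U u with hB'
  set q := bourMomentum κ τ m a U u with hq'
  set b := a - τ * ρ ^ 2 / B with hb
  have hs : bourS κ τ m a U u = ρ ^ 2 / B := rfl
  have hs₁ := hU.deriv_bourS hI hu
  obtain ⟨D, hD⟩ : ∃ D, D = 1 - 2 * a * τ + (4 * τ ^ 2 - κ) * ρ ^ 2 / (2 * B) := ⟨_, rfl⟩
  obtain ⟨ω₁, hω₁'⟩ : ∃ w, w = ρ * ρ₁ * D / (B ^ 2 * (m * U u)) := ⟨_, rfl⟩
  replace hω₁ : HasDerivAt (fun v => m * U v) ω₁ u := hω₁.congr_deriv (by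
    rw [hω₁', hD, hs]; ring)
  obtain ⟨ζ₂, hζ₂'⟩ : ∃ x, x = (ω₁ * B ^ 2 * q + m * U u * B * (κ * ρ * ρ₁) * q
    + m * U u * B ^ 2 * q₁) / ρ ^ 2 - 2 * (m * U u) * B ^ 2 * q * ρ₁ / ρ ^ 3 := ⟨_, rfl⟩
  obtain ⟨ϑ₂, hϑ₂'⟩ : ∃ x, x = -(((-τ * deriv (bourS κ τ m a U) u) * B ^ 2 * q
      + b * B * (κ * ρ * ρ₁) * q + b * B ^ 2 * q₁) / (ρ ^ 2 * (m * U u)))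
      + b * B ^ 2 * q * (2 * ρ * ρ₁ * (m * U u) + ρ ^ 2 * ω₁) / (ρ ^ 2 * (m * U u)) ^ 2 := ⟨_, rfl⟩
  have hU0 := (hU.pos u hu).ne'
  have hζ₂ : HasDerivAt (bourXi2Integrand κ τ m a U) ζ₂ u := by
    refine ((((hω₁.fun_mul (hB₁.fun_pow 2)).fun_mul hq).fun_div (hρ₁.fun_pow 2)
      (pow_ne_zero 2 hx)).congr_of_eventuallyEq
      (Filter.eventuallyEq_of_mem (hI.mem_nhds hu) fun v hv => hU.xi2Integrand_eq hv)).congr_deriv ?_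
    rw [hζ₂', ← hρ, ← hB', ← hq']
    simp only [Nat.cast_ofNat, Nat.add_one_sub_one, pow_one]
    field_simp
  have hϑ₂ : HasDerivAt (bourThetaIntegrand κ τ m a U) ϑ₂ u := by
    have hS := (hU.contDiffOn_bourS.hasDerivAt_deriv_deriv hI hu).1
    refine ((((((hS.const_mul τ).const_sub a).fun_mul
      (hB₁.fun_pow 2)).fun_mul hq).fun_div ((hρ₁.fun_pow 2).fun_mul hω₁)
      (mul_ne_zero (pow_ne_zero 2 hx) hω)).fun_neg.congr_of_eventuallyEq
      (Filter.eventuallyEq_of_mem (hI.mem_nhds hu) fun v hv => by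
        rw [hU.thetaIntegrand_eq hv, bourS, ← mul_div_assoc])).congr_deriv ?_
    have hb2 : a - τ * bourS κ τ m a U u = b := by rw [hb, hs]; ring
    rw [hϑ₂', hb2, ← hρ, ← hB', ← hq']
    simp only [Nat.cast_ofNat, Nat.add_one_sub_one, pow_one]
    field_simp
    ring
  have key := _root_.meanCurvature_eq_zero_iff (τ := τ) (a := a) (B := B) (b := b) hm hx hω rfl hB rfl
    (hU.mul_U_sq_eq hu) (hU.bourMomentum_sq hI hu) hD hω₁' hs₁ (hU.deriv_deriv_bourS hI hu)
    (hU.thetaIntegrand_eq hu) hϑ₂' (hU.xi2Integrand_eq hu) hζ₂'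
    (hΨ (u, t)) (partialU_helicoidal hΨ hρ₁ (hϑ u hu) (hξ₂ u hu) t)
    (partialT_helicoidal hΨ (u, t))
    (partialU_partialU_helicoidal hI hΨ
      (fun v hv => (hU.contDiffOn_bourXi1.hasDerivAt_deriv_deriv hI hv).1) hϑ hξ₂ hu hρ₂ hϑ₂ hζ₂ t)
    (partialT_partialT_helicoidal hΨ (u, t))
  rwa [mul_div_assoc κ, ← hs] at key

/-- On a surface of the Bour family that is twice continuously differentiable, the function
`√R / B` is differentiable. -/
theorem BourAdmissible.differentiableAt_bourMomentum (hU : BourAdmissible κ τ m a U I)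
    (hI : IsOpen I) (hξ₂ : ∀ u ∈ I, HasDerivAt ξ₂ (bourXi2Integrand κ τ m a U u) u)
    (hϑ : ∀ u ∈ I, HasDerivAt ϑ (bourThetaIntegrand κ τ m a U u) u)
    (h : ContDiffOn ℝ 2 (bourSurface κ τ m a U ξ₂ ϑ) (I ×ˢ Set.univ)) {u : ℝ} (hu : u ∈ I) :
    DifferentiableAt ℝ (bourMomentum κ τ m a U) u := by
  have hnhds := hI.mem_nhds hu
  -- Ψ being C², its velocity along t = 0 is differentiable. The integrands of ϑ and ξ₂ can be read
  -- off from it, and √R/B from the latter, without differentiating a square root.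
  set F : ℝ → Fin 3 → ℝ := fun v => partialU (bourSurface κ τ m a U ξ₂ ϑ) (v, 0) with hFdef
  have hF : DifferentiableAt ℝ F u := by
    have h1 : ContDiffOn ℝ (1 + 1) (fun u => bourSurface κ τ m a U ξ₂ ϑ (u, 0)) I := by
      rw [one_add_one_eq_two]
      exact h.comp (by fun_prop) fun _ hu => ⟨hu, Set.mem_univ _⟩
    rw [contDiffOn_succ_iff_deriv_of_isOpen hI] at h1
    exact (h1.2.2.differentiableOn one_ne_zero u hu).differentiableAt hnhds
  have hFc (i : Fin 3) : DifferentiableAt ℝ (fun v => F v i) u := differentiableAt_pi.1 hF i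
  have hFv : ∀ v ∈ I, F v = rotZ (0 / m + ϑ v) ![deriv (bourXi1 κ τ m a U) v,
      bourThetaIntegrand κ τ m a U v * bourXi1 κ τ m a U v,
      bourXi2Integrand κ τ m a U v + a * bourThetaIntegrand κ τ m a U v] := fun v hv =>
    partialU_helicoidal (bourSurface_eq_rotZ κ τ m a U ξ₂ ϑ)
      (hU.contDiffOn_bourXi1.hasDerivAt_deriv_deriv hI hv).1 (hϑ v hv) (hξ₂ v hv) 0
  have hϑd := (hϑ u hu).differentiableAt
  have hx := (hU.contDiffOn_bourXi1.hasDerivAt_deriv_deriv hI hu).1.differentiableAt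
  have hUd := (hU.contDiffOn.hasDerivAt_deriv_deriv hI hu).1.differentiableAt
  have hBd := (hU.hasDerivAt_bourB hI hu).differentiableAt
  have hx0 := (hU.bourXi1_pos hu).ne'
  have hB0 := (hU.bourB_pos hu).ne'
  have hU0 := (hU.pos u hu).ne'
  have hm := hU.m_ne_zero
  have h0 := hFc 0
  have h1 := hFc 1
  have h2 := hFc 2
  have htheta : DifferentiableAt ℝ (bourThetaIntegrand κ τ m a U) u := by
    have h3 : DifferentiableAt ℝ
        (fun v => (Real.cos (ϑ v) * F v 1 - Real.sin (ϑ v) * F v 0) / bourXi1 κ τ m a U v) u := by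
      fun_prop (disch := assumption)
    refine h3.congr_of_eventuallyEq (Filter.eventuallyEq_of_mem hnhds fun v hv => ?_)
    have hsc := Real.sin_sq_add_cos_sq (ϑ v)
    simp only [hFv v hv, rotZ, zero_div, zero_add, Matrix.cons_val_zero, Matrix.cons_val_one]
    rw [eq_div_iff (hU.bourXi1_pos hv).ne']
    linear_combination (-(bourThetaIntegrand κ τ m a U v * bourXi1 κ τ m a U v)) * hsc
  have hfin : DifferentiableAt ℝ (fun v => (F v 2 - a * bourThetaIntegrand κ τ m a U v)
      * bourXi1 κ τ m a U v ^ 2 / (m * U v * bourB κ τ m a U v ^ 2)) u := by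
    have hne : m * U u * bourB κ τ m a U u ^ 2 ≠ 0 := by positivity
    fun_prop (disch := assumption)
  refine hfin.congr_of_eventuallyEq (Filter.eventuallyEq_of_mem hnhds fun v hv => ?_)
  have e : F v 2 - a * bourThetaIntegrand κ τ m a U v = bourXi2Integrand κ τ m a U v := by
    simp [hFv v hv, rotZ]
  have hx1 := (hU.bourXi1_pos hv).ne'
  have hB1 := (hU.bourB_pos hv).ne'
  have hU1 := (hU.pos v hv).ne'
  simp only [e, hU.xi2Integrand_eq hv]
  field_simp

theorem ContDiffOn.of_hasDerivAt {f f' : ℝ → ℝ} {I : Set ℝ} (hI : IsOpen I)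
    (hf : ∀ u ∈ I, HasDerivAt f (f' u) u) (hf' : ContDiffOn ℝ 1 f' I) : ContDiffOn ℝ 2 f I := by
  rw [← one_add_one_eq_two, contDiffOn_succ_iff_deriv_of_isOpen hI]
  exact ⟨fun u hu => (hf u hu).differentiableAt.differentiableWithinAt, by simp,
    hf'.congr fun u hu => (hf u hu).deriv⟩

/-- If `s = ξ₁² / B` satisfies `s'' = 2 - κ s`, then `√R / B` is constant. -/
theorem BourAdmissible.exists_bourMomentum_eq (hU : BourAdmissible κ τ m a U I)
    (hI : IsOpen I) (hIc : IsPreconnected I)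
    (hode : ∀ u ∈ I, deriv (deriv (bourS κ τ m a U)) u = 2 - κ * bourS κ τ m a U u) :
    ∃ C, ∀ u ∈ I, bourMomentum κ τ m a U u = C := by
  have hder : ∀ u ∈ I, HasDerivAt (fun v => bourMomentum κ τ m a U v ^ 2) 0 u := by
    intro u hu
    obtain ⟨h1, h2⟩ := hU.contDiffOn_bourS.hasDerivAt_deriv_deriv hI hu
    refine (((h1.fun_sub ((h1.fun_pow 2).const_mul (κ / 4))).fun_sub
      ((h2.fun_pow 2).div_const 4)).congr_of_eventuallyEq (Filter.eventuallyEq_of_mem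
      (hI.mem_nhds hu) fun v hv => hU.bourMomentum_sq_eq_bourS hI hv)).congr_deriv ?_
    rw [hode u hu]
    simp only [Nat.cast_ofNat, Nat.add_one_sub_one, pow_one]
    ring
  obtain ⟨C, hC⟩ := hI.exists_is_const_of_deriv_eq_zero hIc
    (fun u hu => (hder u hu).differentiableAt.differentiableWithinAt) fun u hu => (hder u hu).deriv
  -- As √R/B is nonnegative, constancy of its square suffices.
  exact ⟨Real.sqrt C, fun u hu => by rw [← hC u hu, Real.sqrt_sq (hU.bourMomentum_nonneg hu)]⟩

/-- A surface of the Bour family is minimal if and only if `s = ξ₁² / B` satisfies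
`s'' = 2 - κ s`. -/
theorem BourAdmissible.isMinimal_iff (hU : BourAdmissible κ τ m a U I)
    (hI : IsOpen I) (hIc : IsPreconnected I)
    (hξ₂ : ∀ u ∈ I, HasDerivAt ξ₂ (bourXi2Integrand κ τ m a U u) u)
    (hϑ : ∀ u ∈ I, HasDerivAt ϑ (bourThetaIntegrand κ τ m a U u) u) :
    IsMinimalBourSurface κ τ m a U ξ₂ ϑ I ↔
      ∀ u ∈ I, deriv (deriv (bourS κ τ m a U)) u = 2 - κ * bourS κ τ m a U u := by
  constructor
  · intro h u hu
    have hq := (hU.differentiableAt_bourMomentum hI hξ₂ hϑ h.contDiffOn hu).hasDerivAt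
    have hH := (hU.meanCurvature_eq_zero_iff hI hξ₂ hϑ hu hq 0).2.1
      (h.meanCurvature_eq_zero (u, 0) ⟨hu, Set.mem_univ _⟩)
    obtain ⟨h1, h2⟩ := hU.contDiffOn_bourS.hasDerivAt_deriv_deriv hI hu
    have hsq := (hq.fun_pow 2).unique
      (((h1.fun_sub ((h1.fun_pow 2).const_mul (κ / 4))).fun_sub
      ((h2.fun_pow 2).div_const 4)).congr_of_eventuallyEq (Filter.eventuallyEq_of_mem
      (hI.mem_nhds hu) fun v hv => hU.bourMomentum_sq_eq_bourS hI hv))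
    simp only [Nat.cast_ofNat, Nat.add_one_sub_one, pow_one] at hsq
    have hP := hU.bourMomentum_sq_eq_bourS hI hu
    have hs := hU.bourS_pos hu
    have hks := hU.kappa_mul_bourS_lt hu
    set s := bourS κ τ m a U u
    set s₁ := deriv (bourS κ τ m a U) u
    set s₂ := deriv (deriv (bourS κ τ m a U)) u
    set q := bourMomentum κ τ m a U u
    set q₁ := deriv (bourMomentum κ τ m a U) u
    -- By the formula for q² this is s(4 − κs), up to sign the determinant of the linear system for
    -- q' and 2 − κs − s''.
    have hpos : 0 < s₁ ^ 2 + 4 * q ^ 2 := by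
      rw [hP]
      nlinarith
    have hq₁ : q₁ = 0 := by
      have : q₁ * (s₁ ^ 2 + 4 * q ^ 2) = 0 := by linear_combination s₁ * hH + 2 * q * hsq
      exact (mul_eq_zero.1 this).resolve_right hpos.ne'
    rw [hq₁] at hH hsq
    have : (2 - κ * s - s₂) * (s₁ ^ 2 + 4 * q ^ 2) = 0 := by
      linear_combination 4 * q * hH - 2 * s₁ * hsq
    linarith [(mul_eq_zero.1 this).resolve_right hpos.ne']
  · intro hode
    -- Constancy of √R/B also makes the integrands of ξ₂ and ϑ continuously differentiable, whence Ψ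
    -- is C² even if R vanishes.
    obtain ⟨C, hC⟩ := hU.exists_bourMomentum_eq hI hIc hode
    have hq : ∀ u ∈ I, HasDerivAt (bourMomentum κ τ m a U) 0 u := fun u hu =>
      (hasDerivAt_const u C).congr_of_eventuallyEq
        (Filter.eventuallyEq_of_mem (hI.mem_nhds hu) hC)
    have hmc := fun (x : ℝ × ℝ) (hx : x ∈ I ×ˢ Set.univ) =>
      hU.meanCurvature_eq_zero_iff hI hξ₂ hϑ hx.1 (hq x.1 hx.1) x.2
    have hx := hU.contDiffOn_bourXi1
    have hx1 := hx.of_le one_le_two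
    have hU1 := hU.contDiffOn.of_le one_le_two
    have hB1 := hU.contDiffOn_bourB.of_le one_le_two
    have hζ2 : ContDiffOn ℝ 2 ξ₂ I := by
      refine .of_hasDerivAt hI hξ₂ (ContDiffOn.congr (f := fun u => m * U u
        * bourB κ τ m a U u ^ 2 * C / bourXi1 κ τ m a U u ^ 2) ?_ fun u hu => by
          rw [hU.xi2Integrand_eq hu, hC u hu])
      exact ContDiffOn.div (by fun_prop) (by fun_prop) fun u hu =>
        pow_ne_zero 2 (hU.bourXi1_pos hu).ne'
    have hϑ2 : ContDiffOn ℝ 2 ϑ I := by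
      refine .of_hasDerivAt hI hϑ (ContDiffOn.congr (f := fun u =>
        -((a - τ * bourXi1 κ τ m a U u ^ 2 / bourB κ τ m a U u) * bourB κ τ m a U u ^ 2
        * C / (bourXi1 κ τ m a U u ^ 2 * (m * U u)))) ?_ fun u hu => by
          rw [hU.thetaIntegrand_eq hu, hC u hu])
      have hd : ContDiffOn ℝ 1
          (fun u => τ * bourXi1 κ τ m a U u ^ 2 / bourB κ τ m a U u) I :=
        ContDiffOn.div (by fun_prop) hB1 fun u hu => (hU.bourB_pos hu).ne'
      exact (ContDiffOn.div (by fun_prop) (by fun_prop) fun u hu => mul_ne_zero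
        (pow_ne_zero 2 (hU.bourXi1_pos hu).ne') (mul_ne_zero hU.m_ne_zero (hU.pos u hu).ne')).neg
    refine ⟨?_, fun x hx => ?_, fun x hx => (hmc x hx).1, fun x hx => (hmc x hx).2.2 ?_⟩
    · have hfst : Set.MapsTo (Prod.fst : ℝ × ℝ → ℝ) (I ×ˢ Set.univ) I := fun _ h => h.1
      have c1 := hx.comp (contDiff_fst (𝕜 := ℝ) (E := ℝ) (F := ℝ)).contDiffOn hfst
      have c2 := hζ2.comp (contDiff_fst (𝕜 := ℝ) (E := ℝ) (F := ℝ)).contDiffOn hfst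
      have c3 := hϑ2.comp (contDiff_fst (𝕜 := ℝ) (E := ℝ) (F := ℝ)).contDiffOn hfst
      simp only [Function.comp_def] at c1 c2 c3
      have c4 : ContDiffOn ℝ 2 (fun x : ℝ × ℝ => x.2 / m + ϑ x.1) (I ×ˢ Set.univ) :=
        (contDiff_snd.div_const m).contDiffOn.add c3
      rw [contDiffOn_pi]
      intro i
      fin_cases i
      exacts [c1.mul c4.cos, c1.mul c4.sin, c2.add (contDiffOn_const.mul c4)]
    · rw [bourSurface_eq_rotZ, bcvSpace, Set.mem_ofPred_eq, bcvB_rotZ]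
      simpa [bcvB, bourB] using hU.bourB_pos hx.1
    · rw [hode _ hx.1]
      ring

end Minimality

/-! ### Second order linear equations with constant coefficients on an interval -/

section LinearEquations

variable {I : Set ℝ} {x x₁ : ℝ → ℝ} {k w : ℝ}

theorem eqOn_of_hasDerivAt_zero (hI : IsOpen I) (hIc : IsPreconnected I) {f : ℝ → ℝ}
    (hf : ∀ u ∈ I, HasDerivAt f 0 u) (hw : w ∈ I) : ∀ u ∈ I, f u = f w := by
  obtain ⟨C, hC⟩ := hI.exists_is_const_of_deriv_eq_zero hIc
    (fun u hu => (hf u hu).differentiableAt.differentiableWithinAt) fun u hu => (hf u hu).deriv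
  exact fun u hu => (hC u hu).trans (hC w hw).symm

theorem hasDerivAt_mul_sub (k u₀ u : ℝ) : HasDerivAt (fun v => k * (v - u₀)) k u := by
  simpa using ((hasDerivAt_id u).sub_const u₀).const_mul k

/-- Solutions of `x'' = -k² x` in amplitude-phase form. -/
theorem exists_eq_sin (hI : IsOpen I) (hIc : IsPreconnected I) (hk : k ≠ 0) (hw : w ∈ I)
    (hx : ∀ u ∈ I, HasDerivAt x (x₁ u) u) (hx₁ : ∀ u ∈ I, HasDerivAt x₁ (-(k ^ 2 * x u)) u) :
    ∃ u₀, ∀ u ∈ I, x u = Real.sqrt (x w ^ 2 + x₁ w ^ 2 / k ^ 2) * Real.sin (k * (u - u₀)) := by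
  have hlin (u : ℝ) := hasDerivAt_mul_sub k w u
  -- Turning the phase vector (x, x'/k) back by the angle k(u − w) freezes it; its two coordinates
  -- are the first integrals.
  have h1 := eqOn_of_hasDerivAt_zero hI hIc (f := fun u => x u * Real.cos (k * (u - w))
    - x₁ u / k * Real.sin (k * (u - w))) (fun u hu => (((hx u hu).fun_mul (hlin u).cos).fun_sub
      (((hx₁ u hu).div_const k).fun_mul (hlin u).sin)).congr_deriv (by field_simp; ring)) hw
  have h2 := eqOn_of_hasDerivAt_zero hI hIc (f := fun u => x u * Real.sin (k * (u - w))
    + x₁ u / k * Real.cos (k * (u - w))) (fun u hu => (((hx u hu).fun_mul (hlin u).sin).fun_add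
      (((hx₁ u hu).div_const k).fun_mul (hlin u).cos)).congr_deriv (by field_simp; ring)) hw
  simp only [sub_self, mul_zero, Real.cos_zero, Real.sin_zero, mul_one, sub_zero, zero_add] at h1 h2
  set α := x w
  set β := x₁ w / k
  have hsq : x w ^ 2 + x₁ w ^ 2 / k ^ 2 = α ^ 2 + β ^ 2 := by simp only [α, β, div_pow]
  rw [hsq]
  -- The solution is α cos + β sin, so amplitude and phase are the modulus and argument of β + iα;
  -- amplitude zero needs no separate treatment.
  set ψ : ℂ := ⟨β, α⟩ with hψ
  have hnorm : ‖ψ‖ = Real.sqrt (α ^ 2 + β ^ 2) := by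
    rw [Complex.norm_def, Complex.normSq_mk]
    congr 1
    ring
  have hc : Real.sqrt (α ^ 2 + β ^ 2) * Real.cos ψ.arg = β := by
    rw [← hnorm, Complex.norm_mul_cos_arg]
  have hs : Real.sqrt (α ^ 2 + β ^ 2) * Real.sin ψ.arg = α := by
    rw [← hnorm, Complex.norm_mul_sin_arg]
  refine ⟨w - ψ.arg / k, fun u hu => ?_⟩
  have e : k * (u - (w - ψ.arg / k)) = k * (u - w) + ψ.arg := by field_simp; ring
  have hsc := Real.sin_sq_add_cos_sq (k * (u - w))
  rw [e, Real.sin_add]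
  linear_combination -(x u) * hsc + Real.cos (k * (u - w)) * h1 u hu
    + Real.sin (k * (u - w)) * h2 u hu - Real.sin (k * (u - w)) * hc - Real.cos (k * (u - w)) * hs

/-- Negative solutions of `x'' = k² x` with positive energy. -/
theorem exists_eq_cosh (hI : IsOpen I) (hIc : IsPreconnected I) (hk : k ≠ 0) (hw : w ∈ I)
    (hx : ∀ u ∈ I, HasDerivAt x (x₁ u) u) (hx₁ : ∀ u ∈ I, HasDerivAt x₁ (k ^ 2 * x u) u)
    (hneg : x w < 0) (hpos : 0 < x w ^ 2 - x₁ w ^ 2 / k ^ 2) :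
    ∃ u₀, ∀ u ∈ I, x u
      = -(Real.sqrt (x w ^ 2 - x₁ w ^ 2 / k ^ 2) * Real.cosh (k * (u - u₀))) := by
  have hlin (u : ℝ) := hasDerivAt_mul_sub k w u
  have h1 := eqOn_of_hasDerivAt_zero hI hIc (f := fun u => x u * Real.cosh (k * (u - w))
    - x₁ u / k * Real.sinh (k * (u - w))) (fun u hu => (((hx u hu).fun_mul (hlin u).cosh).fun_sub
      (((hx₁ u hu).div_const k).fun_mul (hlin u).sinh)).congr_deriv (by field_simp; ring)) hw
  have h2 := eqOn_of_hasDerivAt_zero hI hIc (f := fun u => x₁ u / k * Real.cosh (k * (u - w))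
    - x u * Real.sinh (k * (u - w))) (fun u hu => ((((hx₁ u hu).div_const k).fun_mul
      (hlin u).cosh).fun_sub ((hx u hu).fun_mul (hlin u).sinh)).congr_deriv
      (by field_simp; ring)) hw
  simp only [sub_self, mul_zero, Real.cosh_zero, Real.sinh_zero, mul_one, sub_zero] at h1 h2
  obtain ⟨A, hA⟩ : ∃ A, A = Real.sqrt (x w ^ 2 - x₁ w ^ 2 / k ^ 2) := ⟨_, rfl⟩
  have hA0 : 0 < A := hA ▸ Real.sqrt_pos.2 hpos
  have hAsq : A ^ 2 = x w ^ 2 - (x₁ w / k) ^ 2 := by rw [hA, Real.sq_sqrt hpos.le, div_pow]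
  rw [← hA]
  set α := x w
  set β := x₁ w / k
  -- The hyperbolic phase is fixed by A sinh = β. The energy then gives A cosh = ±α, and α < 0
  -- selects −α.
  have hsinh : A * Real.sinh (Real.arsinh (β / A)) = β := by
    rw [Real.sinh_arsinh]
    field_simp
  have hcosh : A * Real.cosh (Real.arsinh (β / A)) = -α := by
    have h3 := Real.cosh_sq (Real.arsinh (β / A))
    have h4 : 0 < A * Real.cosh (Real.arsinh (β / A)) := mul_pos hA0 (Real.cosh_pos _)
    have h5 : (A * Real.cosh (Real.arsinh (β / A))) ^ 2 = (-α) ^ 2 := by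
      rw [mul_pow, h3, mul_add, ← mul_pow, hsinh, hAsq]
      ring
    exact (pow_left_inj₀ h4.le (by linarith) two_ne_zero).1 h5
  refine ⟨w + Real.arsinh (β / A) / k, fun u hu => ?_⟩
  have e : k * (u - (w + Real.arsinh (β / A) / k)) = k * (u - w) - Real.arsinh (β / A) := by
    field_simp
    ring
  have hsc := Real.cosh_sq (k * (u - w))
  rw [e, Real.cosh_sub]
  linear_combination -(x u) * hsc + Real.cosh (k * (u - w)) * h1 u hu
    + Real.sinh (k * (u - w)) * h2 u hu - Real.sinh (k * (u - w)) * hsinh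
    + Real.cosh (k * (u - w)) * hcosh

/-- Solutions of `x'' = 2`. -/
theorem exists_eq_sq_add (hI : IsOpen I) (hIc : IsPreconnected I) (hw : w ∈ I)
    (hx : ∀ u ∈ I, HasDerivAt x (x₁ u) u) (hx₁ : ∀ u ∈ I, HasDerivAt x₁ 2 u) :
    ∃ u₀, ∀ u ∈ I, x u = (u - u₀) ^ 2 + (x w - x₁ w ^ 2 / 4) := by
  have h1 := eqOn_of_hasDerivAt_zero hI hIc (f := fun u => x₁ u - 2 * (u - w))
    (fun u hu => ((hx₁ u hu).fun_sub (hasDerivAt_mul_sub 2 w u)).congr_deriv (by ring)) hw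
  have h2 := eqOn_of_hasDerivAt_zero hI hIc (f := fun u => x u - x₁ u ^ 2 / 4)
    (fun u hu => ((hx u hu).fun_sub (((hx₁ u hu).fun_pow 2).div_const 4)).congr_deriv
      (by simp; ring)) hw
  simp only [sub_self, mul_zero, sub_zero] at h1 h2
  refine ⟨w - x₁ w / 2, fun u hu => ?_⟩
  have h3 : x₁ u = x₁ w + 2 * (u - w) := by linarith [h1 u hu]
  have h4 := h2 u hu
  rw [h3] at h4
  linear_combination h4

theorem deriv_deriv_of_eqOn (hI : IsOpen I) {f f₁ : ℝ → ℝ} {f₂ u : ℝ} (h : ∀ v ∈ I, x v = f v)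
    (hf : ∀ v, HasDerivAt f (f₁ v) v) (hf₁ : HasDerivAt f₁ f₂ u) (hu : u ∈ I) :
    deriv (deriv x) u = f₂ := by
  have h1 : ∀ v ∈ I, deriv x v = f₁ v := fun v hv =>
    ((hf v).congr_of_eventuallyEq (Filter.eventuallyEq_of_mem (hI.mem_nhds hv) h)).deriv
  exact (hf₁.congr_of_eventuallyEq (Filter.eventuallyEq_of_mem (hI.mem_nhds hu) h1)).deriv

theorem deriv_deriv_of_eq_sin (hI : IsOpen I) {κ A u₀ : ℝ} (hk : k ≠ 0) (hκ : κ = k ^ 2)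
    (h : ∀ u ∈ I, κ / 2 * x u - 1 = A * Real.sin (k * (u - u₀))) :
    ∀ u ∈ I, deriv (deriv x) u = 2 - κ * x u := by
  intro u hu
  have hκ0 : κ ≠ 0 := hκ ▸ pow_ne_zero 2 hk
  have hlin (v : ℝ) := hasDerivAt_mul_sub k u₀ v
  refine (deriv_deriv_of_eqOn hI (f := fun v => 2 / κ * (1 + A * Real.sin (k * (v - u₀))))
    (fun v hv => ?_) (fun v => (((hlin v).sin.const_mul A).const_add 1).const_mul (2 / κ))
    (((((hlin u).cos.mul_const k).const_mul A)).const_mul (2 / κ)) hu).trans ?_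
  · rw [← h v hv]
    field_simp
    ring
  · have h1 := h u hu
    have h2 : κ * x u = 2 * (1 + A * Real.sin (k * (u - u₀))) := by linear_combination 2 * h1
    rw [h2, hκ]
    field_simp
    ring

theorem deriv_deriv_of_eq_cosh (hI : IsOpen I) {κ A u₀ : ℝ} (hk : k ≠ 0) (hκ : κ = -k ^ 2)
    (h : ∀ u ∈ I, κ / 2 * x u - 1 = A * Real.cosh (k * (u - u₀))) :
    ∀ u ∈ I, deriv (deriv x) u = 2 - κ * x u := by
  intro u hu
  have hκ0 : κ ≠ 0 := hκ ▸ neg_ne_zero.2 (pow_ne_zero 2 hk)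
  have hlin (v : ℝ) := hasDerivAt_mul_sub k u₀ v
  refine (deriv_deriv_of_eqOn hI (f := fun v => 2 / κ * (1 + A * Real.cosh (k * (v - u₀))))
    (fun v hv => ?_) (fun v => (((hlin v).cosh.const_mul A).const_add 1).const_mul (2 / κ))
    (((((hlin u).sinh.mul_const k).const_mul A)).const_mul (2 / κ)) hu).trans ?_
  · rw [← h v hv]
    field_simp
    ring
  · have h1 := h u hu
    have h2 : κ * x u = 2 * (1 + A * Real.cosh (k * (u - u₀))) := by linear_combination 2 * h1
    rw [h2, hκ]
    field_simp
    ring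

theorem deriv_deriv_of_eq_sq_add (hI : IsOpen I) {K u₀ : ℝ}
    (h : ∀ u ∈ I, x u = (u - u₀) ^ 2 + K) : ∀ u ∈ I, deriv (deriv x) u = 2 := fun u hu =>
  deriv_deriv_of_eqOn hI h (f₁ := fun v => 2 * (v - u₀))
    (fun v => ((((hasDerivAt_id v).sub_const u₀).fun_pow 2).add_const K).congr_deriv (by simp))
    (hasDerivAt_mul_sub 2 u₀ u) hu

end LinearEquations

/-! ### Solutions of s'' = 2 − κs parametrized by the conserved quantity -/

namespace BourAdmissible

variable {κ τ m a : ℝ} {U : ℝ → ℝ} {I : Set ℝ}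

/-- The function κs/2 − 1 is a harmonic oscillator with energy 1 − κq², which yields both the
amplitude and the bound κC² ≤ 1. The factor l may be negative: the amplitude stays nonnegative and
the phase absorbs the sign. -/
theorem eq_sin_of_ode (hU : BourAdmissible κ τ m a U I) (hI : IsOpen I) (hIc : IsPreconnected I)
    (hIne : I.Nonempty)
    (hode : ∀ u ∈ I, deriv (deriv (bourS κ τ m a U)) u = 2 - κ * bourS κ τ m a U u)
    {k : ℝ} (hk : k ≠ 0) (hκ : κ = k ^ 2) (l : ℝ) :
    ∃ C u₀ : ℝ, κ * C ^ 2 ≤ 1 ∧ ∀ u ∈ I, l * (κ / 2 * bourS κ τ m a U u - 1)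
      = Real.sqrt (l ^ 2 * (1 - κ * C ^ 2)) * Real.sin (k * (u - u₀)) := by
  obtain ⟨w, hw⟩ := hIne
  have hd : ∀ u ∈ I, _ := fun u hu => hU.contDiffOn_bourS.hasDerivAt_deriv_deriv hI hu
  have hC := hU.bourMomentum_sq_eq_bourS hI hw
  have hen : (κ / 2 * bourS κ τ m a U w - 1) ^ 2
      + (κ / 2 * deriv (bourS κ τ m a U) w) ^ 2 / k ^ 2
      = 1 - κ * bourMomentum κ τ m a U w ^ 2 := by
    rw [hC, hκ]
    field_simp
    ring
  obtain ⟨u₀, hu₀⟩ := exists_eq_sin hI hIc hk hw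
    (x := fun u => l * (κ / 2 * bourS κ τ m a U u - 1))
    (x₁ := fun u => l * (κ / 2 * deriv (bourS κ τ m a U) u))
    (fun u hu => (((hd u hu).1.const_mul (κ / 2)).sub_const 1).const_mul l)
    (fun u hu => (((hd u hu).2.const_mul (κ / 2)).const_mul l).congr_deriv (by
      rw [hode u hu, hκ]; ring))
  refine ⟨bourMomentum κ τ m a U w, u₀, ?_, fun u hu => ?_⟩
  · have : 0 ≤ 1 - κ * bourMomentum κ τ m a U w ^ 2 := by rw [← hen]; positivity
    linarith
  · rw [← hen, hu₀ u hu]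
    congr 2
    ring

/-- For κ < 0 the energy 1 − κq² is positive and κs/2 − 1 is negative because s > 0; this leaves
only the negative hyperbolic cosine. -/
theorem eq_cosh_of_ode (hU : BourAdmissible κ τ m a U I) (hI : IsOpen I)
    (hIc : IsPreconnected I) (hIne : I.Nonempty)
    (hode : ∀ u ∈ I, deriv (deriv (bourS κ τ m a U)) u = 2 - κ * bourS κ τ m a U u)
    {k l : ℝ} (hk : k ≠ 0) (hκ : κ = -k ^ 2) (hl : 0 < l) :
    ∃ C u₀ : ℝ, ∀ u ∈ I, l * (κ / 2 * bourS κ τ m a U u - 1)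
      = -(Real.sqrt (l ^ 2 * (1 - κ * C ^ 2)) * Real.cosh (k * (u - u₀))) := by
  obtain ⟨w, hw⟩ := hIne
  have hd : ∀ u ∈ I, _ := fun u hu => hU.contDiffOn_bourS.hasDerivAt_deriv_deriv hI hu
  have hC := hU.bourMomentum_sq_eq_bourS hI hw
  have hs := hU.bourS_pos hw
  have hk2 : 0 < k ^ 2 := by positivity
  have hen : (l * (κ / 2 * bourS κ τ m a U w - 1)) ^ 2
      - (l * (κ / 2 * deriv (bourS κ τ m a U) w)) ^ 2 / k ^ 2
      = l ^ 2 * (1 - κ * bourMomentum κ τ m a U w ^ 2) := by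
    rw [hC, hκ]
    field_simp
    ring
  obtain ⟨u₀, hu₀⟩ := exists_eq_cosh hI hIc hk hw
    (x := fun u => l * (κ / 2 * bourS κ τ m a U u - 1))
    (x₁ := fun u => l * (κ / 2 * deriv (bourS κ τ m a U) u))
    (fun u hu => (((hd u hu).1.const_mul (κ / 2)).sub_const 1).const_mul l)
    (fun u hu => (((hd u hu).2.const_mul (κ / 2)).const_mul l).congr_deriv (by
      rw [hode u hu, hκ]; ring))
    (mul_neg_of_pos_of_neg hl (by linarith [mul_neg_of_neg_of_pos (by linarith : κ < 0) hs]))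
    (by rw [hen, hκ, neg_mul, sub_neg_eq_add]; positivity)
  exact ⟨bourMomentum κ τ m a U w, u₀, fun u hu => by rw [← hen, hu₀ u hu]⟩

/-- For κ = 0 the minimum s − s'²/4 of the parabola is exactly q². -/
theorem eq_sq_add_of_ode (hU : BourAdmissible 0 τ m a U I) (hI : IsOpen I)
    (hIc : IsPreconnected I) (hIne : I.Nonempty)
    (hode : ∀ u ∈ I, deriv (deriv (bourS 0 τ m a U)) u = 2 - 0 * bourS 0 τ m a U u) :
    ∃ C u₀ : ℝ, ∀ u ∈ I, bourS 0 τ m a U u = (u - u₀) ^ 2 + C ^ 2 := by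
  obtain ⟨w, hw⟩ := hIne
  have hd : ∀ u ∈ I, _ := fun u hu => hU.contDiffOn_bourS.hasDerivAt_deriv_deriv hI hu
  have hC := hU.bourMomentum_sq_eq_bourS hI hw
  obtain ⟨u₀, hu₀⟩ := exists_eq_sq_add hI hIc hw (fun u hu => (hd u hu).1)
    (fun u hu => (hd u hu).2.congr_deriv (by rw [hode u hu]; ring))
  refine ⟨bourMomentum 0 τ m a U w, u₀, fun u hu => ?_⟩
  rw [hu₀ u hu, hC]
  ring

end BourAdmissible

/-! ### The classification in the individual geometries -/

section Classification

variable {κ τ m a : ℝ} {U : ℝ → ℝ} {I : Set ℝ}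

namespace BourAdmissible

theorem ode_iff_euclidean (hU : BourAdmissible 0 0 m a U I) (hI : IsOpen I)
    (hIc : IsPreconnected I) (hIne : I.Nonempty) :
    (∀ u ∈ I, deriv (deriv (bourS 0 0 m a U)) u = 2 - 0 * bourS 0 0 m a U u) ↔
      ∃ c u₀ : ℝ, ∀ u ∈ I, U u ^ 2 = ((u - u₀) ^ 2 + a ^ 2 + c ^ 2 / 4) / m ^ 2 := by
  have hm := pow_ne_zero 2 hU.m_ne_zero
  constructor
  · intro h
    obtain ⟨C, u₀, hs⟩ := hU.eq_sq_add_of_ode hI hIc hIne h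
    refine ⟨2 * C, u₀, fun u hu => ?_⟩
    rw [eq_div_iff hm]
    linear_combination hU.mul_U_sq hu + hs u hu
  · rintro ⟨c, u₀, h⟩ u hu
    rw [deriv_deriv_of_eq_sq_add hI (K := c ^ 2 / 4) (u₀ := u₀) (fun v hv => ?_) u hu, zero_mul,
      sub_zero]
    have h1 := h v hv
    rw [eq_div_iff hm] at h1
    linear_combination h1 - hU.mul_U_sq hv

theorem ode_iff_sphere (hU : BourAdmissible κ τ m a U I) (hI : IsOpen I)
    (hIc : IsPreconnected I) (hIne : I.Nonempty) (hκ : κ = 4 * τ ^ 2) (hτ : τ ≠ 0) :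
    (∀ u ∈ I, deriv (deriv (bourS κ τ m a U)) u = 2 - κ * bourS κ τ m a U u) ↔
      ∃ c u₀ : ℝ, |c| ≤ |1 / τ - 2 * a| ∧ ∀ u ∈ I,
        U u ^ 2 = (1 - 2 * a * τ + 2 * a ^ 2 * τ ^ 2
            + Real.sqrt ((1 - 2 * a * τ) ^ 2 - τ ^ 2 * c ^ 2) * Real.sin (2 * τ * (u - u₀)))
          / (2 * m ^ 2 * τ ^ 2) := by
  have hm := hU.m_ne_zero
  have hden : 2 * m ^ 2 * τ ^ 2 ≠ 0 := by positivity
  have hk : 2 * τ ≠ 0 := by positivity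
  have hκ' : κ = (2 * τ) ^ 2 := by rw [hκ]; ring
  obtain ⟨w, hw⟩ := id hIne
  -- When κ = 4τ² this number is √Δ, and m²U² is affine in s with this slope.
  have hl : 1 - 2 * a * τ ≠ 0 := by
    have := hU.delta_root_pos hw
    rw [hκ] at this
    intro h
    simp [h] at this
  constructor
  · intro h
    obtain ⟨C, u₀, hC, hs⟩ := hU.eq_sin_of_ode hI hIc hIne h hk hκ' (1 - 2 * a * τ)
    refine ⟨2 * C * (1 - 2 * a * τ), u₀, ?_, fun u hu => ?_⟩
    · have e : 1 / τ - 2 * a = (1 - 2 * a * τ) / τ := by field_simp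
      rw [e, ← sq_le_sq, div_pow, le_div_iff₀ (by positivity)]
      rw [hκ] at hC
      nlinarith [mul_le_mul_of_nonneg_left hC (sq_nonneg (1 - 2 * a * τ))]
    · have e : (1 - 2 * a * τ) ^ 2 - τ ^ 2 * (2 * C * (1 - 2 * a * τ)) ^ 2
          = (1 - 2 * a * τ) ^ 2 * (1 - κ * C ^ 2) := by rw [hκ]; ring
      rw [e, ← hs u hu, eq_div_iff hden]
      linear_combination (norm := skip) (2 * τ ^ 2) * hU.mul_U_sq hu
      rw [hκ]
      ring
  · rintro ⟨c, u₀, -, h⟩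
    refine deriv_deriv_of_eq_sin hI hk hκ' (A := Real.sqrt ((1 - 2 * a * τ) ^ 2 - τ ^ 2 * c ^ 2)
      / (1 - 2 * a * τ)) (u₀ := u₀) fun u hu => ?_
    have h1 := h u hu
    rw [eq_div_iff hden] at h1
    rw [div_mul_eq_mul_div (Real.sqrt _), eq_div_iff hl]
    have h2 := hU.mul_U_sq hu
    have h3 : m ^ 2 * U u ^ 2 = a ^ 2 + bourS κ τ m a U u * (1 - 2 * a * τ) := by
      rw [h2, hκ]; ring
    linear_combination h1 - (2 * τ ^ 2) * h3 + (bourS κ τ m a U u * (1 - 2 * a * τ)) / 2 * hκ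

theorem ode_iff_sphere_prod (hU : BourAdmissible κ 0 m a U I) (hI : IsOpen I)
    (hIc : IsPreconnected I) (hIne : I.Nonempty) (hκ : 0 < κ) :
    (∀ u ∈ I, deriv (deriv (bourS κ 0 m a U)) u = 2 - κ * bourS κ 0 m a U u) ↔
      ∃ c u₀ : ℝ, |c| ≤ Real.sqrt κ ∧ ∀ u ∈ I,
        U u ^ 2 = (κ * (a ^ 2 * κ + 1)
            + (c ^ 2 - κ) * Real.sin (Real.sqrt κ * (u - u₀)) ^ 2) / (m ^ 2 * κ ^ 2) := by
  have hm := hU.m_ne_zero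
  have hden : m ^ 2 * κ ^ 2 ≠ 0 := by positivity
  have hk : Real.sqrt κ ≠ 0 := (Real.sqrt_pos.2 hκ).ne'
  have hκ' : κ = Real.sqrt κ ^ 2 := (Real.sq_sqrt hκ.le).symm
  constructor
  · intro h
    obtain ⟨C, u₀, hC, hs⟩ := hU.eq_sin_of_ode hI hIc hIne h hk hκ' 1
    refine ⟨κ * C, u₀, Real.abs_le_sqrt (by nlinarith), fun u hu => ?_⟩
    have h1 := congrArg (· ^ 2) (hs u hu)
    simp only [one_pow, one_mul, mul_pow] at h1
    rw [Real.sq_sqrt (by linarith)] at h1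
    rw [eq_div_iff hden]
    linear_combination κ ^ 2 * hU.mul_U_sq hu - κ * h1
  -- Only the square of κs/2 − 1 is determined by U². Since κs/2 − 1 = −√Δ never vanishes,
  -- connectedness of I yields one global sign, and the equation for s holds with either sign.
  · rintro ⟨c, u₀, hc, h⟩
    have hA : 0 ≤ 1 - c ^ 2 / κ := by
      rw [sub_nonneg, div_le_one hκ, ← sq_abs, hκ']
      exact pow_le_pow_left₀ (abs_nonneg c) hc 2
    have hx : ∀ u ∈ I, κ / 2 * bourS κ 0 m a U u - 1 < 0 := fun u hu => by
      linarith [hU.delta_root_pos hu]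
    have hsq : ∀ u ∈ I, (κ / 2 * bourS κ 0 m a U u - 1) ^ 2
        = (Real.sqrt (1 - c ^ 2 / κ) * Real.sin (Real.sqrt κ * (u - u₀))) ^ 2 := fun u hu => by
      have h1 := h u hu
      rw [eq_div_iff hden] at h1
      rw [mul_pow, Real.sq_sqrt hA]
      have e : κ * (1 - c ^ 2 / κ) = κ - c ^ 2 := by rw [mul_sub, mul_div_cancel₀ _ hκ.ne', mul_one]
      refine mul_left_cancel₀ hκ.ne' ?_
      linear_combination κ ^ 2 * hU.mul_U_sq hu - h1 - Real.sin (Real.sqrt κ * (u - u₀)) ^ 2 * e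
    have hcont := hU.contDiffOn_bourS.continuousOn
    obtain h1 | h1 := hIc.eq_or_eq_neg_of_sq_eq
      (f := fun u => κ / 2 * bourS κ 0 m a U u - 1)
      (g := fun u => Real.sqrt (1 - c ^ 2 / κ) * Real.sin (Real.sqrt κ * (u - u₀)))
      (by fun_prop) (by fun_prop) hsq fun hu h0 => by
        have h2 := hsq _ hu
        rw [h0] at h2
        exact (hx _ hu).ne (by simpa using h2)
    · exact deriv_deriv_of_eq_sin hI hk hκ' h1
    · exact deriv_deriv_of_eq_sin hI hk hκ' (A := -Real.sqrt (1 - c ^ 2 / κ)) (u₀ := u₀)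
        fun u hu => (h1 hu).trans (neg_mul _ _).symm

theorem ode_iff_hyperbolic_prod (hU : BourAdmissible κ 0 m a U I) (hI : IsOpen I)
    (hIc : IsPreconnected I) (hIne : I.Nonempty) (hκ : κ < 0) :
    (∀ u ∈ I, deriv (deriv (bourS κ 0 m a U)) u = 2 - κ * bourS κ 0 m a U u) ↔
      ∃ c u₀ : ℝ, ∀ u ∈ I,
        U u ^ 2 = (κ * (a ^ 2 * κ + 1)
            + (c ^ 2 - κ) * Real.cosh (Real.sqrt (-κ) * (u - u₀)) ^ 2) / (m ^ 2 * κ ^ 2) := by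
  have hm := hU.m_ne_zero
  have hκ0 := hκ.ne
  have hden : m ^ 2 * κ ^ 2 ≠ 0 := by positivity
  have hk : Real.sqrt (-κ) ≠ 0 := (Real.sqrt_pos.2 (neg_pos.2 hκ)).ne'
  have hκ' : κ = -Real.sqrt (-κ) ^ 2 := by rw [Real.sq_sqrt (by linarith), neg_neg]
  constructor
  · intro h
    obtain ⟨C, u₀, hs⟩ := hU.eq_cosh_of_ode hI hIc hIne h hk hκ' one_pos
    refine ⟨κ * C, u₀, fun u hu => ?_⟩
    have h1 := congrArg (· ^ 2) (hs u hu)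
    simp only [one_pow, one_mul, mul_pow, neg_sq] at h1
    rw [Real.sq_sqrt (by nlinarith [sq_nonneg C])] at h1
    rw [eq_div_iff hden]
    linear_combination κ ^ 2 * hU.mul_U_sq hu - κ * h1
  · rintro ⟨c, u₀, h⟩
    have hA : 0 ≤ 1 - c ^ 2 / κ := by
      linarith [div_nonpos_of_nonneg_of_nonpos (sq_nonneg c) hκ.le]
    refine deriv_deriv_of_eq_cosh hI hk hκ' (A := -Real.sqrt (1 - c ^ 2 / κ)) (u₀ := u₀)
      fun u hu => ?_
    have h1 := h u hu
    rw [eq_div_iff hden] at h1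
    -- The bases of both squares are nonnegative: the left one is √Δ, the right one a multiple of
    -- cosh. So the squares may be dropped.
    have hsq : (-(κ / 2 * bourS κ 0 m a U u - 1)) ^ 2
        = (Real.sqrt (1 - c ^ 2 / κ) * Real.cosh (Real.sqrt (-κ) * (u - u₀))) ^ 2 := by
      rw [mul_pow, Real.sq_sqrt hA]
      have e : κ * (1 - c ^ 2 / κ) = κ - c ^ 2 := by rw [mul_sub, mul_div_cancel₀ _ hκ0, mul_one]
      refine mul_left_cancel₀ hκ0 ?_
      linear_combination κ ^ 2 * hU.mul_U_sq hu - h1 - Real.cosh (Real.sqrt (-κ) * (u - u₀)) ^ 2 * e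
    have hx := hU.delta_root_pos hu
    have h2 := (pow_left_inj₀ (by linarith) (by positivity) two_ne_zero).1 hsq
    linarith

theorem ode_iff_heisenberg (hU : BourAdmissible 0 τ m a U I) (hI : IsOpen I)
    (hIc : IsPreconnected I) (hIne : I.Nonempty) (hτ : τ ≠ 0) :
    (∀ u ∈ I, deriv (deriv (bourS 0 τ m a U)) u = 2 - 0 * bourS 0 τ m a U u) ↔
      ∃ c u₀ : ℝ, ∀ u ∈ I,
        0 < 2 * τ ^ 2 * (u - u₀) ^ 2 + 1 - 2 * a * τ + c ^ 2 / (8 * τ ^ 2) ∧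
        U u ^ 2 = ((2 * τ ^ 2 * (u - u₀) ^ 2 + 1 - 2 * a * τ + c ^ 2 / (8 * τ ^ 2)) ^ 2
            + 4 * a * τ - 1) / (4 * m ^ 2 * τ ^ 2) := by
  have hm := hU.m_ne_zero
  have hden : 4 * m ^ 2 * τ ^ 2 ≠ 0 := by positivity
  constructor
  · intro h
    obtain ⟨C, u₀, hs⟩ := hU.eq_sq_add_of_ode hI hIc hIne h
    -- This choice of c turns W into √Δ = 1 − 2aτ + 2τ²s.
    refine ⟨4 * τ ^ 2 * C, u₀, fun u hu => ?_⟩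
    have e : 2 * τ ^ 2 * (u - u₀) ^ 2 + 1 - 2 * a * τ + (4 * τ ^ 2 * C) ^ 2 / (8 * τ ^ 2)
        = 1 - 2 * a * τ + (4 * τ ^ 2 - 0) * bourS 0 τ m a U u / 2 := by
      rw [hs u hu]
      field_simp
      ring
    rw [e]
    refine ⟨hU.delta_root_pos hu, ?_⟩
    rw [eq_div_iff hden]
    linear_combination (4 * τ ^ 2) * hU.mul_U_sq hu
  · rintro ⟨c, u₀, h⟩ u hu
    rw [deriv_deriv_of_eq_sq_add hI (K := c ^ 2 / (16 * τ ^ 4)) (u₀ := u₀) (fun v hv => ?_) u hu,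
      zero_mul, sub_zero]
    obtain ⟨hpos, h1⟩ := h v hv
    rw [eq_div_iff hden] at h1
    have h2 := (pow_left_inj₀ (hU.delta_root_pos hv).le hpos.le two_ne_zero).1
      (by linear_combination h1 - (4 * τ ^ 2) * hU.mul_U_sq hv)
    field_simp at h2 ⊢
    linear_combination (1 / 2) * h2

/-- This completes the square in the polynomial for m²U². The squared bracket is κ√Δ, so its sign is
that of κ; hence W > 0 for κ > 0 and W < 0 for κ < 0. -/
theorem kappa_sq_mul_U_sq (hU : BourAdmissible κ τ m a U I) {u : ℝ} (hu : u ∈ I) :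
    m ^ 2 * κ ^ 2 * (4 * τ ^ 2 - κ) * U u ^ 2 = κ ^ 2 * (4 * a * τ - a ^ 2 * κ - 1)
      + (4 * τ ^ 2 - 2 * a * κ * τ + (4 * τ ^ 2 - κ) * (κ / 2 * bourS κ τ m a U u - 1)) ^ 2 := by
  linear_combination κ ^ 2 * (4 * τ ^ 2 - κ) * hU.mul_U_sq hu

theorem ode_iff_su2 (hU : BourAdmissible κ τ m a U I) (hI : IsOpen I)
    (hIc : IsPreconnected I) (hIne : I.Nonempty) (hκ : 0 < κ) (hne : κ ≠ 4 * τ ^ 2) :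
    (∀ u ∈ I, deriv (deriv (bourS κ τ m a U)) u = 2 - κ * bourS κ τ m a U u) ↔
      ∃ c u₀ : ℝ, |c| ≤ |4 * τ ^ 2 - κ| / Real.sqrt κ ∧ ∀ u ∈ I,
        0 < 4 * τ ^ 2 - 2 * a * κ * τ
            + Real.sqrt ((4 * τ ^ 2 - κ) ^ 2 - c ^ 2 * κ) * Real.sin (Real.sqrt κ * (u - u₀)) ∧
        U u ^ 2 = (κ ^ 2 * (4 * a * τ - a ^ 2 * κ - 1)
            + (4 * τ ^ 2 - 2 * a * κ * τ
              + Real.sqrt ((4 * τ ^ 2 - κ) ^ 2 - c ^ 2 * κ)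
                * Real.sin (Real.sqrt κ * (u - u₀))) ^ 2)
          / (m ^ 2 * κ ^ 2 * (4 * τ ^ 2 - κ)) := by
  have hm := hU.m_ne_zero
  have hl : 4 * τ ^ 2 - κ ≠ 0 := sub_ne_zero.2 hne.symm
  have hden : m ^ 2 * κ ^ 2 * (4 * τ ^ 2 - κ) ≠ 0 := by positivity
  have hk0 := Real.sqrt_pos.2 hκ
  have hκ' : κ = Real.sqrt κ ^ 2 := (Real.sq_sqrt hκ.le).symm
  have hpos : ∀ u ∈ I, 0 < 4 * τ ^ 2 - 2 * a * κ * τ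
      + (4 * τ ^ 2 - κ) * (κ / 2 * bourS κ τ m a U u - 1) := fun u hu => by
    linarith [mul_pos hκ (hU.delta_root_pos hu)]
  constructor
  · intro h
    obtain ⟨C, u₀, hC, hs⟩ := hU.eq_sin_of_ode hI hIc hIne h hk0.ne' hκ' (4 * τ ^ 2 - κ)
    refine ⟨C * (4 * τ ^ 2 - κ), u₀, ?_, fun u hu => ?_⟩
    · rw [le_div_iff₀ hk0, ← abs_of_pos hk0, ← abs_mul, ← sq_le_sq, mul_pow _ (Real.sqrt κ), ← hκ']
      nlinarith [mul_le_mul_of_nonneg_left hC (sq_nonneg (4 * τ ^ 2 - κ))]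
    · have e : (4 * τ ^ 2 - κ) ^ 2 - (C * (4 * τ ^ 2 - κ)) ^ 2 * κ
          = (4 * τ ^ 2 - κ) ^ 2 * (1 - κ * C ^ 2) := by ring
      rw [e, ← hs u hu]
      refine ⟨hpos u hu, ?_⟩
      rw [eq_div_iff hden, ← hU.kappa_sq_mul_U_sq hu]
      ring
  · rintro ⟨c, u₀, -, h⟩
    refine deriv_deriv_of_eq_sin hI hk0.ne' hκ' (A := Real.sqrt ((4 * τ ^ 2 - κ) ^ 2 - c ^ 2 * κ)
      / (4 * τ ^ 2 - κ)) (u₀ := u₀) fun u hu => ?_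
    obtain ⟨hW, h1⟩ := h u hu
    rw [eq_div_iff hden] at h1
    -- κ√Δ and W have equal squares and are both positive, so they agree and s is recovered as an
    -- affine function of the sine.
    have h2 := (pow_left_inj₀ (hpos u hu).le hW.le two_ne_zero).1
      (by linear_combination h1 - hU.kappa_sq_mul_U_sq hu)
    rw [div_mul_eq_mul_div (Real.sqrt _), eq_div_iff hl]
    linear_combination h2

theorem ode_iff_sl2 (hU : BourAdmissible κ τ m a U I) (hI : IsOpen I)
    (hIc : IsPreconnected I) (hIne : I.Nonempty) (hκ : κ < 0) :
    (∀ u ∈ I, deriv (deriv (bourS κ τ m a U)) u = 2 - κ * bourS κ τ m a U u) ↔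
      ∃ c u₀ : ℝ, ∀ u ∈ I,
        4 * τ ^ 2 - 2 * a * κ * τ
            - Real.sqrt ((4 * τ ^ 2 - κ) ^ 2 - c ^ 2 * κ)
              * Real.cosh (Real.sqrt (-κ) * (u - u₀)) < 0 ∧
        U u ^ 2 = (κ ^ 2 * (4 * a * τ - a ^ 2 * κ - 1)
            + (4 * τ ^ 2 - 2 * a * κ * τ
              - Real.sqrt ((4 * τ ^ 2 - κ) ^ 2 - c ^ 2 * κ)
                * Real.cosh (Real.sqrt (-κ) * (u - u₀))) ^ 2)
          / (m ^ 2 * κ ^ 2 * (4 * τ ^ 2 - κ)) := by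
  have hm := hU.m_ne_zero
  have hκ0 := hκ.ne
  have hl : 0 < 4 * τ ^ 2 - κ := by nlinarith [sq_nonneg τ]
  have hden : m ^ 2 * κ ^ 2 * (4 * τ ^ 2 - κ) ≠ 0 := by positivity
  have hk : Real.sqrt (-κ) ≠ 0 := (Real.sqrt_pos.2 (neg_pos.2 hκ)).ne'
  have hκ' : κ = -Real.sqrt (-κ) ^ 2 := by rw [Real.sq_sqrt (by linarith), neg_neg]
  have hneg : ∀ u ∈ I, 4 * τ ^ 2 - 2 * a * κ * τ
      + (4 * τ ^ 2 - κ) * (κ / 2 * bourS κ τ m a U u - 1) < 0 := fun u hu => by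
    linarith [mul_neg_of_neg_of_pos hκ (hU.delta_root_pos hu)]
  constructor
  · intro h
    obtain ⟨C, u₀, hs⟩ := hU.eq_cosh_of_ode hI hIc hIne h hk hκ' hl
    refine ⟨C * (4 * τ ^ 2 - κ), u₀, fun u hu => ?_⟩
    have e : (4 * τ ^ 2 - κ) ^ 2 - (C * (4 * τ ^ 2 - κ)) ^ 2 * κ
        = (4 * τ ^ 2 - κ) ^ 2 * (1 - κ * C ^ 2) := by ring
    rw [e, sub_eq_add_neg _ (Real.sqrt _ * _), ← hs u hu]
    refine ⟨hneg u hu, ?_⟩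
    rw [eq_div_iff hden, ← hU.kappa_sq_mul_U_sq hu]
    ring
  · rintro ⟨c, u₀, h⟩
    refine deriv_deriv_of_eq_cosh hI hk hκ' (A := -Real.sqrt ((4 * τ ^ 2 - κ) ^ 2 - c ^ 2 * κ)
      / (4 * τ ^ 2 - κ)) (u₀ := u₀) fun u hu => ?_
    obtain ⟨hW, h1⟩ := h u hu
    rw [eq_div_iff hden] at h1
    have h2 := (pow_left_inj₀ (neg_pos.2 (hneg u hu)).le (neg_pos.2 hW).le two_ne_zero).1
      (by linear_combination h1 - hU.kappa_sq_mul_U_sq hu)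
    rw [div_mul_eq_mul_div (-Real.sqrt _), eq_div_iff hl.ne']
    linear_combination -h2

end BourAdmissible

end Classification

/-! ### The seven geometries together -/

theorem corollary4p6 (κ τ m a : ℝ) (I : Set ℝ) (hIopen : IsOpen I) (hIconn : I.OrdConnected)
    (hIne : I.Nonempty) (U ξ₂ ϑ : ℝ → ℝ) (hU : BourAdmissible κ τ m a U I)
    (hξ₂ : ∀ u ∈ I, HasDerivAt ξ₂ (bourXi2Integrand κ τ m a U u) u)
    (hϑ : ∀ u ∈ I, HasDerivAt ϑ (bourThetaIntegrand κ τ m a U u) u) :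
    (κ = 0 → τ = 0 →
      (IsMinimalBourSurface κ τ m a U ξ₂ ϑ I ↔
        ∃ c u₀ : ℝ, ∀ u ∈ I,
          U u ^ 2 = ((u - u₀) ^ 2 + a ^ 2 + c ^ 2 / 4) / m ^ 2)) ∧
    (κ = 4 * τ ^ 2 → τ ≠ 0 →
      (IsMinimalBourSurface κ τ m a U ξ₂ ϑ I ↔
        ∃ c u₀ : ℝ, |c| ≤ |1 / τ - 2 * a| ∧ ∀ u ∈ I,
          U u ^ 2 = (1 - 2 * a * τ + 2 * a ^ 2 * τ ^ 2
              + Real.sqrt ((1 - 2 * a * τ) ^ 2 - τ ^ 2 * c ^ 2) * Real.sin (2 * τ * (u - u₀)))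
            / (2 * m ^ 2 * τ ^ 2))) ∧
    (0 < κ → τ = 0 →
      (IsMinimalBourSurface κ τ m a U ξ₂ ϑ I ↔
        ∃ c u₀ : ℝ, |c| ≤ Real.sqrt κ ∧ ∀ u ∈ I,
          U u ^ 2 = (κ * (a ^ 2 * κ + 1)
              + (c ^ 2 - κ) * Real.sin (Real.sqrt κ * (u - u₀)) ^ 2) / (m ^ 2 * κ ^ 2))) ∧
    (κ < 0 → τ = 0 →
      (IsMinimalBourSurface κ τ m a U ξ₂ ϑ I ↔
        ∃ c u₀ : ℝ, ∀ u ∈ I,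
          U u ^ 2 = (κ * (a ^ 2 * κ + 1)
              + (c ^ 2 - κ) * Real.cosh (Real.sqrt (-κ) * (u - u₀)) ^ 2) / (m ^ 2 * κ ^ 2))) ∧
    (κ = 0 → τ ≠ 0 →
      (IsMinimalBourSurface κ τ m a U ξ₂ ϑ I ↔
        ∃ c u₀ : ℝ, ∀ u ∈ I,
          0 < 2 * τ ^ 2 * (u - u₀) ^ 2 + 1 - 2 * a * τ + c ^ 2 / (8 * τ ^ 2) ∧
          U u ^ 2 = ((2 * τ ^ 2 * (u - u₀) ^ 2 + 1 - 2 * a * τ + c ^ 2 / (8 * τ ^ 2)) ^ 2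
              + 4 * a * τ - 1) / (4 * m ^ 2 * τ ^ 2))) ∧
    (0 < κ → τ ≠ 0 → κ ≠ 4 * τ ^ 2 →
      (IsMinimalBourSurface κ τ m a U ξ₂ ϑ I ↔
        ∃ c u₀ : ℝ, |c| ≤ |4 * τ ^ 2 - κ| / Real.sqrt κ ∧ ∀ u ∈ I,
          0 < 4 * τ ^ 2 - 2 * a * κ * τ
              + Real.sqrt ((4 * τ ^ 2 - κ) ^ 2 - c ^ 2 * κ) * Real.sin (Real.sqrt κ * (u - u₀)) ∧
          U u ^ 2 = (κ ^ 2 * (4 * a * τ - a ^ 2 * κ - 1)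
              + (4 * τ ^ 2 - 2 * a * κ * τ
                + Real.sqrt ((4 * τ ^ 2 - κ) ^ 2 - c ^ 2 * κ)
                  * Real.sin (Real.sqrt κ * (u - u₀))) ^ 2)
            / (m ^ 2 * κ ^ 2 * (4 * τ ^ 2 - κ)))) ∧
    (κ < 0 → τ ≠ 0 →
      (IsMinimalBourSurface κ τ m a U ξ₂ ϑ I ↔
        ∃ c u₀ : ℝ, ∀ u ∈ I,
          4 * τ ^ 2 - 2 * a * κ * τ
              - Real.sqrt ((4 * τ ^ 2 - κ) ^ 2 - c ^ 2 * κ)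
                * Real.cosh (Real.sqrt (-κ) * (u - u₀)) < 0 ∧
          U u ^ 2 = (κ ^ 2 * (4 * a * τ - a ^ 2 * κ - 1)
              + (4 * τ ^ 2 - 2 * a * κ * τ
                - Real.sqrt ((4 * τ ^ 2 - κ) ^ 2 - c ^ 2 * κ)
                  * Real.cosh (Real.sqrt (-κ) * (u - u₀))) ^ 2)
            / (m ^ 2 * κ ^ 2 * (4 * τ ^ 2 - κ)))) := by
  have hIc := hIconn.isPreconnected
  rw [hU.isMinimal_iff hIopen hIc hξ₂ hϑ]
  refine ⟨?_, fun hκ hτ => hU.ode_iff_sphere hIopen hIc hIne hκ hτ, ?_, ?_, ?_,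
    fun hκ _ hne => hU.ode_iff_su2 hIopen hIc hIne hκ hne,
    fun hκ _ => hU.ode_iff_sl2 hIopen hIc hIne hκ⟩
  · rintro rfl rfl
    exact hU.ode_iff_euclidean hIopen hIc hIne
  · rintro hκ rfl
    exact hU.ode_iff_sphere_prod hIopen hIc hIne hκ
  · rintro hκ rfl
    exact hU.ode_iff_hyperbolic_prod hIopen hIc hIne hκ
  · rintro rfl hτ
    exact hU.ode_iff_heisenberg hIopen hIc hIne hτ
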